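/- Let $m\in\{2,3\}$. Let $\mathbb{R}_{0,m+1}$ be the real Clifford algebra with generators $e_0,\dots,e_m$, $e_\alpha e_\beta+e_\beta e_\alpha=-2\delta_{\alpha\beta}$, let $\mathbb{R}_{0,m}$ be the subalgebra generated by $e_1,\dots,e_m$, and $\overline{e_0}=-e_0$. Write $\underline{x}=\sum_{j=1}^m x_je_j$, $r=|\underline{x}|$ (also denoted $\rho$ when $m=3$), $\underline{\omega}=\underline{x}/r$, $x=x_0e_0+\underline{x}$, $\underline{\partial}=\sum_{j=1}^m e_j\partial_{x_j}$, $\overline{D}=\tfrac12(\partial_{x_0}-\overline{e_0}\,\underline{\partial})$, and let $\sigma_{m+1}=2\pi^{(m+1)/2}/\Gamma(\tfrac{m+1}2)$. On the half-space $x_0>0$ put $$C_{-1}=\frac1{\sigma_{m+1}}\frac{x\,\overline{e_0}}{|x|^{m+1}},\qquad C_{-k}=\overline{D}^{\,k-1}C_{-1}\quad(k=1,2,\dots),$$ and write $C_{-k}=\tfrac12A_{-k}+\tfrac12\overline{e_0}B_{-k}$ with $A_{-k},B_{-k}$ taking values in $\mathbb{R}_{0,m}$. (1) $A_{-k}$ and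 $B_{-k}$ are continuous on $x_0>0$, and there $A_{-k-1}=\partial_{x_0}A_{-k}=-\underline{\partial}B_{-k}$ and $B_{-k-1}=\partial_{x_0}B_{-k}=-\underline{\partial}A_{-k}$ for all $k\ge1$. (2) $A_{-k}$ is real-valued and $B_{-k}$ is vector-valued, and for all $k\ge1$, $x_0>0$, $\underline{x}\ne0$: if $m=2$, $$A_{-k}=\frac{(-1)^{k+1}}{2\pi}\,k!\,\frac{1\cdot3\cdots(2k-1)}{(k+1)(k+2)\cdots(2k)}\,\frac{r^k}{(x_0^2+r^2)^{k+1/2}}\,i^k\,C_k^{-k}\!\Big(i\frac{x_0}{r}\Big),$$ $$B_{-k}=\frac{(-1)^{k}}{2\pi}\,(k-1)!\,\frac{3\cdot5\cdots(2k-1)}{(k+2)(k+3)\cdots(2k)}\,\frac{r^{k-1}\underline{x}}{(x_0^2+r^2)^{k+1/2}}\,i^{k-1}\,C_{k-1}^{-k}\!\Big(i\frac{x_0}{r}\Big);$$ if $m=3$, $$A_{-k}=\frac{(-1)^{k+1}}{\pi^2}\,\frac{2^{k-1}(k!)^2}{(k+2)(k+3)\cdots(2k+1)}\,\frac{\rho^k}{(x_0^2+\rho^2)^{k+1}}\,i^k\,C_k^{-k-1/2}\!\Big(i\frac{x_0}{\rho}\Big),$$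 $$B_{-k}=\frac{(-1)^{k}}{\pi^2}\,\frac{2^{k-1}(k-1)!\,k!}{(k+3)(k+4)\cdots(2k+1)}\,\frac{\rho^{k-1}\underline{x}}{(x_0^2+\rho^2)^{k+1}}\,i^{k-1}\,C_{k-1}^{-k-1/2}\!\Big(i\frac{x_0}{\rho}\Big).$$ Empty products are $1$, and $C_n^{\lambda}(z)=\sum_{j=0}^{\lfloor n/2\rfloor}(-1)^j\frac{(\lambda)_{n-j}}{j!\,(n-2j)!}(2z)^{n-2j}$ is the Gegenbauer polynomial, with $(\lambda)_i=\lambda(\lambda+1)\cdots(\lambda+i-1)$. (3) Let $\delta$ be the Dirac distribution in $\mathbb{R}^m$ and $H=-\frac{2}{\sigma_{m+1}}\,\mathrm{Pv}\,\frac{\underline{\omega}}{r^m}$ the Hilbert kernel, that is, $H=-\frac1{2\pi}\mathrm{Pv}\frac{\underline{\omega}}{r^2}$ if $m=2$ and $H=-\frac1{\pi^2}\mathrm{Pv}\frac{\underline{\omega}}{\rho^3}$ if $m=3$. The limits $a_{-k}=\lim_{x_0\to0+}A_{-k}(x_0,\cdot)$ and $b_{-k}=\lim_{x_0\to0+}B_{-k}(x_0,\cdot)$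 exist as distributions on $\mathbb{R}^m$; $a_{-1}=\delta$, $b_{-1}=H$, and for $\ell=1,2,\dots$ $$a_{-2\ell}=(-\underline{\partial})^{2\ell-1}H,\quad b_{-2\ell}=(-\underline{\partial})^{2\ell-1}\delta,\quad a_{-2\ell-1}=\underline{\partial}^{2\ell}\delta,\quad b_{-2\ell-1}=\underline{\partial}^{2\ell}H.$$ Moreover, with $\mathrm{Fp}\,K$ denoting the distribution whose value at a test function $\varphi$ is the Hadamard finite part of $\int_{|\underline{x}|>\varepsilon}\varphi K\,d\underline{x}$ as $\varepsilon\to0+$: if $m=2$, $$a_{-2\ell}=\frac{(-1)^{\ell-1}}{2\pi}(2\ell-1)!!\,(2\ell-1)!!\;\mathrm{Fp}\frac1{r^{2\ell+1}},\qquad b_{-2\ell-1}=\frac{(-1)^{\ell-1}}{2\pi}(2\ell-1)!!\,(2\ell+1)!!\;\mathrm{Fp}\frac{1}{r^{2\ell+2}}\,\underline{\omega};$$ if $m=3$, $$a_{-2\ell}=\frac{(-1)^{\ell-1}2^{\ell-1}}{\pi^2}(2\ell-1)!!\,\ell!\;\mathrm{Fp}\frac1{\rho^{2\ell+2}},\qquad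 b_{-2\ell-1}=\frac{(-1)^{\ell-1}2^{\ell}}{\pi^2}(2\ell-1)!!\,(\ell+1)!\;\mathrm{Fp}\frac{1}{\rho^{2\ell+3}}\,\underline{\omega}.$$ -/

import Mathlib

open Filter Topology MeasureTheory Set
open scoped Nat

noncomputable section

namespace HalfSpace

/-- Euclidean space `ℝ^m`. -/
abbrev E (m : ℕ) : Type := EuclideanSpace ℝ (Fin m)

/-- The quadratic form `v ↦ -(v₀² + ⋯ + v_m²)` on `ℝ^{m+1}`. -/
abbrev negForm (m : ℕ) : QuadraticForm ℝ (Fin (m + 1) → ℝ) :=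
  QuadraticMap.weightedSumSquares ℝ (fun _ : Fin (m + 1) => (-1 : ℝ))

/-- The universal real Clifford algebra `ℝ_{0,m+1}`. -/
abbrev Cl (m : ℕ) : Type := CliffordAlgebra (negForm m)

/-- The linear basis `(e_A)`, `A ⊆ {0,…,m}`, of `ℝ_{0,m+1}`, transported from the basis of
`e_{j₁} ∧ ⋯ ∧ e_{j_h}` of the exterior algebra. -/
def clBasis (m : ℕ) : Module.Basis (Finset (Fin (m + 1))) ℝ (Cl m) :=
  (Pi.basisFun ℝ (Fin (m + 1))).ExteriorAlgebra.map
    (CliffordAlgebra.equivExterior (negForm m)).symm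

/-- Coordinates with respect to `clBasis`. -/
def clCoord (m : ℕ) : Cl m ≃ₗ[ℝ] EuclideanSpace ℝ (Finset (Fin (m + 1))) :=
  (clBasis m).equivFun ≪≫ₗ (WithLp.linearEquiv 2 ℝ (Finset (Fin (m + 1)) → ℝ)).symm

/- The Clifford algebra is a finite-dimensional real vector space, so derivatives, integrals and
limits in it do not depend on the norm; the norm used is `|∑ a_A e_A|² = ∑ a_A²`. -/
instance (m : ℕ) : NormedAddCommGroup (Cl m) :=
  NormedAddCommGroup.induced (Cl m) (EuclideanSpace ℝ (Finset (Fin (m + 1)))) (clCoord m)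
    (clCoord m).injective

instance (m : ℕ) : NormedSpace ℝ (Cl m) :=
  NormedSpace.induced ℝ (Cl m) (EuclideanSpace ℝ (Finset (Fin (m + 1)))) (clCoord m)

instance (m : ℕ) : FiniteDimensional ℝ (Cl m) := Module.Finite.of_basis (clBasis m)

/-- The generators `e₀, e₁, …, e_m`. -/
def e (m : ℕ) (j : Fin (m + 1)) : Cl m := CliffordAlgebra.ι (negForm m) (Pi.single j 1)

/-- The Clifford conjugate of `e₀`. -/
def ebar0 (m : ℕ) : Cl m := star (e m 0)

/-- The vector variable `x₁ e₁ + ⋯ + x_m e_m`. -/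
def vec {m : ℕ} (x : E m) : Cl m := ∑ j : Fin m, x j • e m j.succ

/-- `ω = x / |x|`. -/
def omega {m : ℕ} (x : E m) : Cl m := ‖x‖⁻¹ • vec x

/-- The subalgebra `ℝ_{0,m}` of `ℝ_{0,m+1}` generated by `e₁, …, e_m`. -/
def subCl (m : ℕ) : Subalgebra ℝ (Cl m) :=
  Algebra.adjoin ℝ (Set.range fun j : Fin m => e m j.succ)

/-- The algebra automorphism of `ℝ_{0,m+1}` that fixes `e₁, …, e_m` and sends `e₀` to `-e₀`. -/
def flip0 {m : ℕ} (a : Cl m) : Cl m := ebar0 m * CliffordAlgebra.involute a * e m 0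

/-- The component `p` of `a = p + ē₀ q`, where `p` and `q` lie in `ℝ_{0,m}`. -/
def realPart {m : ℕ} (a : Cl m) : Cl m := (1 / 2 : ℝ) • (a + flip0 a)

/-- The component `q` of `a = p + ē₀ q`, where `p` and `q` lie in `ℝ_{0,m}`. -/
def imagPart {m : ℕ} (a : Cl m) : Cl m := (1 / 2 : ℝ) • (e m 0 * (a - flip0 a))

/-! ### Differential operators and potentials

Functions on the half-space are written as functions of `x₀` and `x = (x₁, …, x_m)`. -/

/-- The partial derivative with respect to `x₀`. -/
def partial0 {m : ℕ} (F : ℝ → E m → Cl m) (x₀ : ℝ) (x : E m) : Cl m :=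
  deriv (fun t => F t x) x₀

/-- The Dirac operator `∑ e_j ∂_{x_j}`, `j = 1, …, m`. -/
def dirac {m : ℕ} (f : E m → Cl m) (x : E m) : Cl m :=
  ∑ j : Fin m, e m j.succ * lineDeriv ℝ f x (EuclideanSpace.single j 1)

/-- The conjugate Cauchy-Riemann operator `(∂_{x₀} - ē₀ ∂) / 2`, with `∂` the Dirac operator. -/
def crBar {m : ℕ} (F : ℝ → E m → Cl m) (x₀ : ℝ) (x : E m) : Cl m :=
  (1 / 2 : ℝ) • (partial0 F x₀ x - ebar0 m * dirac (F x₀) x)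

/-- The area `2 π^{n/2} / Γ(n/2)` of the unit sphere in `ℝ^n`. -/
def sphereArea (n : ℕ) : ℝ := 2 * Real.pi ^ ((n : ℝ) / 2) / Real.Gamma ((n : ℝ) / 2)

/-- The Cauchy kernel `x ē₀ / (σ_{m+1} |x|^{m+1})`, where here `x = x₀ e₀ + x₁ e₁ + ⋯ + x_m e_m`. -/
def cauchyKernel (m : ℕ) (x₀ : ℝ) (x : E m) : Cl m :=
  (1 / (sphereArea (m + 1) * Real.sqrt (x₀ ^ 2 + ‖x‖ ^ 2) ^ (m + 1))) •
    ((x₀ • e m 0 + vec x) * ebar0 m)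

/-- The downstream potential `C_{-k}`, for `k = 1, 2, …`. -/
def C (m k : ℕ) : ℝ → E m → Cl m := crBar^[k - 1] (cauchyKernel m)

/-- The potential `A_{-k}`, twice the real part of `C_{-k}`. -/
def A (m k : ℕ) (x₀ : ℝ) (x : E m) : Cl m := (2 : ℝ) • realPart (C m k x₀ x)

/-- The potential `B_{-k}`, twice the imaginary part of `C_{-k}`. -/
def B (m k : ℕ) (x₀ : ℝ) (x : E m) : Cl m := (2 : ℝ) • imagPart (C m k x₀ x)

/-- The Gegenbauer polynomial
`C_n^a(X) = ∑_{j ≤ n/2} (-1)^j (a)_{n-j} / (j! (n-2j)!) (2X)^{n-2j}`,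
where `(a)_i = a (a+1) ⋯ (a+i-1)`. -/
def gegenbauer (n : ℕ) (a : ℝ) : Polynomial ℝ :=
  ∑ j ∈ Finset.range (n / 2 + 1),
    Polynomial.C ((-1) ^ j * (ascPochhammer ℝ (n - j)).eval a / ((j ! : ℝ) * ((n - 2 * j)! : ℝ))) *
      (2 * Polynomial.X) ^ (n - 2 * j)

/-! ### Clifford distributions -/

/-- The `ℝ_{0,m+1}`-valued distributions on `ℝ^m`. -/
abbrev CliffDist (m : ℕ) : Type := Distribution (⊤ : TopologicalSpace.Opens (E m)) (Cl m) ⊤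

/-- The Dirac delta distribution at the origin. -/
def delta (m : ℕ) : CliffDist m :=
  Distribution.mapCLM (ContinuousLinearMap.toSpanSingleton ℝ (1 : Cl m)) (Distribution.delta 0)

/-- The Dirac operator `∑ e_j ∂_{x_j}` on distributions. -/
def diracD {m : ℕ} (T : CliffDist m) : CliffDist m :=
  ∑ j : Fin m, Distribution.mapCLM
    (LinearMap.toContinuousLinearMap (LinearMap.mulLeft ℝ (e m j.succ)))
    (LineDeriv.lineDerivOp (EuclideanSpace.single j (1 : ℝ)) T)

/-- `T = lim_{x₀ → 0+} F(x₀, ·)` in the sense of distributions. -/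
def IsBoundaryValue {m : ℕ} (F : ℝ → E m → Cl m) (T : CliffDist m) : Prop :=
  ∀ f : TestFunction (⊤ : TopologicalSpace.Opens (E m)) ℝ ⊤,
    (∀ x₀ : ℝ, 0 < x₀ → Integrable (fun x => f x • F x₀ x)) ∧
    Tendsto (fun x₀ : ℝ => ∫ x, f x • F x₀ x) (𝓝[>] 0) (𝓝 (T f))

/-- `T = Pv K`, for a kernel `K` on `ℝ^m ∖ {0}`. -/
def IsPrincipalValue {m : ℕ} (K : E m → Cl m) (T : CliffDist m) : Prop :=
  ∀ f : TestFunction (⊤ : TopologicalSpace.Opens (E m)) ℝ ⊤,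
    Tendsto (fun ε : ℝ => ∫ x in {x : E m | ε < ‖x‖}, f x • K x) (𝓝[>] 0) (𝓝 (T f))

/-- `L` is the Hadamard finite part of `G(ε)` as `ε → 0+`: for some `N` and some coefficients,
`G(ε) = ∑_{1 ≤ j ≤ N} c_j ε^{-j} + d log ε + L + o(1)`. -/
def HasFinitePart {V : Type*} [NormedAddCommGroup V] [NormedSpace ℝ V] (G : ℝ → V) (L : V) :
    Prop :=
  ∃ (N : ℕ) (c : ℕ → V) (d : V),
    Tendsto (fun ε : ℝ => G ε - ∑ j ∈ Finset.Icc 1 N, (ε ^ j)⁻¹ • c j - Real.log ε • d)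
      (𝓝[>] 0) (𝓝 L)

/-- `T = Fp K`, for a kernel `K` on `ℝ^m ∖ {0}`: the value of `T` at a test function `f` is the
Hadamard finite part of `∫_{|x| > ε} f K`, that is, in spherical coordinates, of
`∫_ε^∞ r^{m-1} ∫_{|ω| = 1} f(r ω) K(r ω) dω dr`. -/
def IsFinitePart {m : ℕ} (K : E m → Cl m) (T : CliffDist m) : Prop :=
  ∀ f : TestFunction (⊤ : TopologicalSpace.Opens (E m)) ℝ ⊤,
    HasFinitePart (fun ε : ℝ => ∫ x in {x : E m | ε < ‖x‖}, f x • K x) (T f)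

end HalfSpace

end

/-! Put p = (m-1)/2 and σ = σ_{m+1}. The function (x₀² + |x|²)^(-p) is harmonic on ℝ^(m+1) away from
the origin, and almost everything comes from A_0 = -(σp)⁻¹ (x₀² + |x|²)^(-p). The Cauchy kernel is
½(∂_{x₀} - ē₀∂)A_0, so A_{-1} = ∂_{x₀}A_0 and B_{-1} = -∂A_0. Since ∂ anticommutes with ē₀ and, by
harmonicity, ∂² = -Δ acts on A_0 as ∂_{x₀}², each further application of the conjugate
Cauchy-Riemann operator differentiates both components once in x₀. This gives A_{-k} = `potA m k`
and B_{-k-1} = `potB m k` (`C_succ_eq`), and the relations between them are `dirac_potA` and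
`dirac_potB`.

Gegenbauer formulas: ∂_t^k (t² + s)^(-p) is a polynomial divided by (t² + s)^(p+k). The coefficients
satisfy a two-term recursion solved by quotients of Pochhammer symbols and factorials
(`powCoeff_eq`); after a reflection of Pochhammer symbols they are those of C_k^{1/2-p-k} at it/r
(`aeval_gegenbauer`). A_{-k} uses this with p and B_{-k} with p + 1 and k - 1; only constants then
depend on m.

Boundary values: A_0 tends to a multiple of |x|^(1-m), which is locally integrable, by dominated
convergence; A_{-1} is the Poisson kernel, an approximate identity of mass 1, so it tends to δ.
Distributional limits commute with ∂ (`IsBoundaryValue.neg_dirac`). With H defined as -∂ of the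
limit of A_0, every other limit is an iterate of -∂ on δ or on H.

Finite parts: for a kernel of degree 1-m-n and parity (-1)^n, integration by parts on |x| > ε
produces a boundary term ε^(-n) g(ε) with g smooth and g(-ε) = (-1)^(n+1) g(ε). The Taylor
coefficient of g of order n is therefore zero, so the boundary term has only negative powers of ε
and no constant: the finite part commutes with differentiation (`hasExpansion_setIntegral_deriv`).
Starting from |x|^(1-m), the kernels c/|x|^a and c x/|x|^a alternate under ∂ and always have the
right parity, so the iterates of ∂ are finite parts of the pointwise derivatives, with coefficients
`fpCoeff`. The order of the expansion is tracked because order 0 means an honest limit, which is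
what makes H a principal value. -/

noncomputable section

namespace HalfSpace

/-! ### Derivatives of powers of `t² + s` -/

/-- The coefficient of `t^(k-2j) s^j` in `(t² + s)^(p+k) ∂_t^k (t² + s)^(-p)`. -/
def powCoeff (p : ℝ) : ℕ → ℕ → ℝ
  | 0, 0 => 1
  | 0, _ + 1 => 0
  | k + 1, 0 => -(k + 2 * p) * powCoeff p k 0
  | k + 1, j + 1 => -(k + 2 * p + 2 * (j + 1)) * powCoeff p k (j + 1) + (k - 2 * j) * powCoeff p k j

/-- The factor `k - 2 * j` in the recursion vanishes exactly where index `j` would feed a negative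
power of `t`. This makes the truncated exponents `k - 2 * j` and the overlong range in `powNum`
harmless. -/
theorem powCoeff_eq_zero (p : ℝ) : ∀ {k j : ℕ}, k < 2 * j → powCoeff p k j = 0
  | 0, 0, h => by simp at h
  | 0, _ + 1, _ => by simp [powCoeff]
  | k + 1, 0, h => by simp at h
  | k + 1, j + 1, h => by
    rw [powCoeff, powCoeff_eq_zero p (by omega : k < 2 * (j + 1))]
    rcases (by omega : k < 2 * j ∨ k = 2 * j) with h' | h'
    · rw [powCoeff_eq_zero p h']; ring
    · subst h'; push_cast; ring

/-- The polynomial `(t² + s)^(p+k) ∂_t^k (t² + s)^(-p)`. -/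
def powNum (p : ℝ) (k : ℕ) (t s : ℝ) : ℝ :=
  ∑ j ∈ Finset.range (k + 1), powCoeff p k j * t ^ (k - 2 * j) * s ^ j

/-- The derivative `∂_t^k (t² + s)^(-p)`. -/
def powDeriv (p : ℝ) (k : ℕ) (t s : ℝ) : ℝ := powNum p k t s * (t ^ 2 + s) ^ (-(p + k))

@[simp] theorem powNum_zero (p t s : ℝ) : powNum p 0 t s = 1 := by simp [powNum, powCoeff]

theorem powDeriv_zero (p t s : ℝ) : powDeriv p 0 t s = (t ^ 2 + s) ^ (-p) := by
  simp [powDeriv]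

/-- The product rule for `powNum p k t s * (t ^ 2 + s) ^ (-(p + k))` in `t`, with the power `-(p + k
+ 1)` taken out. -/
theorem powNum_succ (p : ℝ) (k : ℕ) (t s : ℝ) :
    (t ^ 2 + s) * (∑ j ∈ Finset.range (k + 1),
      powCoeff p k j * ((k - 2 * j : ℕ) * t ^ (k - 2 * j - 1)) * s ^ j)
      - 2 * (p + k) * t * powNum p k t s = powNum p (k + 1) t s := by
  have h1 : ∀ j, (t ^ 2 + s) * (powCoeff p k j * ((k - 2 * j : ℕ) * t ^ (k - 2 * j - 1)) * s ^ j)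
      - 2 * (p + k) * t * (powCoeff p k j * t ^ (k - 2 * j) * s ^ j) =
      -(k + 2 * p + 2 * j) * powCoeff p k j * t ^ (k + 1 - 2 * j) * s ^ j +
      (k - 2 * j) * powCoeff p k j * t ^ (k + 1 - 2 * (j + 1)) * s ^ (j + 1) := by
    intro j
    -- The cases follow the truncated subtraction: zero coefficient, constant power of `t`, and
    -- genuine exponent.
    rcases lt_trichotomy k (2 * j) with h | h | h
    · rw [powCoeff_eq_zero p h]; ring
    · subst h
      rw [show 2 * j + 1 - 2 * j = 1 by omega]; push_cast; simp; ring
    · obtain ⟨n, rfl⟩ : ∃ n, k = 2 * j + n + 1 := ⟨k - 2 * j - 1, by omega⟩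
      rw [show 2 * j + n + 1 - 2 * j - 1 = n by omega, show 2 * j + n + 1 - 2 * j = n + 1 by omega,
        show 2 * j + n + 1 + 1 - 2 * j = n + 2 by omega,
        show 2 * j + n + 1 + 1 - 2 * (j + 1) = n by omega]
      push_cast; ring
  rw [powNum, Finset.mul_sum, Finset.mul_sum, ← Finset.sum_sub_distrib,
    Finset.sum_congr rfl fun j _ => h1 j, Finset.sum_add_distrib, powNum,
    Finset.sum_range_succ' _ (k + 1)]
  -- Shifting the index by one matches the two halves of the recursion; the term added at the top
  -- has coefficient zero.
  have h2 : ∑ j ∈ Finset.range (k + 1), -(k + 2 * p + 2 * j) * powCoeff p k j *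
        t ^ (k + 1 - 2 * j) * s ^ j =
      ∑ j ∈ Finset.range (k + 1), -(k + 2 * p + 2 * (j + 1)) * powCoeff p k (j + 1) *
        t ^ (k + 1 - 2 * (j + 1)) * s ^ (j + 1) + -(k + 2 * p) * powCoeff p k 0 * t ^ (k + 1) := by
    have h3 := Finset.sum_range_succ' (fun j : ℕ => -(k + 2 * p + 2 * j) * powCoeff p k j *
        t ^ (k + 1 - 2 * j) * s ^ j) (k + 1)
    rw [Finset.sum_range_succ, powCoeff_eq_zero p (by omega : k < 2 * (k + 1))] at h3
    simpa using h3
  rw [h2, add_right_comm, ← Finset.sum_add_distrib]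
  simp only [powCoeff]
  congr 1
  · refine Finset.sum_congr rfl fun j _ => ?_
    ring
  · simp

/-- Coefficient form of the fact that ∂_s commutes with ∂_t^k, applied to ∂_s (t² + s)^(-p) = -p (t²
+ s)^(-(p+1)). -/
theorem powCoeff_succ_index (p : ℝ) : ∀ k j : ℕ,
    (j + 1) * powCoeff p k (j + 1) + (j - p - k) * powCoeff p k j = -p * powCoeff (p + 1) k j
  | 0, 0 => by simp [powCoeff]
  | 0, j + 1 => by simp [powCoeff]
  | k + 1, 0 => by
    have h := powCoeff_succ_index p k 0
    simp only [powCoeff]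
    push_cast at h ⊢
    linear_combination (-(k + 2 * p + 2)) * h
  | k + 1, j + 1 => by
    have h := powCoeff_succ_index p k (j + 1)
    have h' := powCoeff_succ_index p k j
    simp only [powCoeff]
    push_cast at h h' ⊢
    linear_combination (-(k + 2 * p + 2 * (j + 1) + 2)) * h + (k - 2 * j) * h'

theorem powNum_succ_index (p : ℝ) (k : ℕ) (t s : ℝ) :
    (t ^ 2 + s) * (∑ j ∈ Finset.range (k + 1),
      powCoeff p k j * t ^ (k - 2 * j) * (j * s ^ (j - 1)))
      - (p + k) * powNum p k t s = -p * powNum (p + 1) k t s := by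
  have h1 : ∀ j, (t ^ 2 + s) * (powCoeff p k j * t ^ (k - 2 * j) * (j * s ^ (j - 1))) =
      j * powCoeff p k j * t ^ (k - 2 * j) * s ^ j +
      j * powCoeff p k j * t ^ (k + 2 - 2 * j) * s ^ (j - 1) := by
    intro j
    rcases lt_or_ge k (2 * j) with h | h
    · rw [powCoeff_eq_zero p h]; ring
    · obtain ⟨n, rfl⟩ : ∃ n, k = 2 * j + n := ⟨k - 2 * j, by omega⟩
      rw [show 2 * j + n - 2 * j = n by omega, show 2 * j + n + 2 - 2 * j = n + 2 by omega]
      rcases j with _ | j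
      · simp
      · simp only [Nat.add_sub_cancel]; ring
  have h2 : ∑ j ∈ Finset.range (k + 1), j * powCoeff p k j * t ^ (k + 2 - 2 * j) * s ^ (j - 1) =
      ∑ j ∈ Finset.range (k + 1), (j + 1) * powCoeff p k (j + 1) * t ^ (k - 2 * j) * s ^ j := by
    have h3 := Finset.sum_range_succ' (fun j : ℕ => j * powCoeff p k j * t ^ (k + 2 - 2 * j) *
      s ^ (j - 1)) (k + 1)
    rw [Finset.sum_range_succ, powCoeff_eq_zero p (by omega : k < 2 * (k + 1))] at h3
    simp only [mul_zero, zero_mul, add_zero, Nat.cast_zero, Nat.add_sub_cancel] at h3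
    rw [h3]
    refine Finset.sum_congr rfl fun j _ => ?_
    rw [show k + 2 - 2 * (j + 1) = k - 2 * j by omega]
    push_cast; ring
  rw [Finset.mul_sum, Finset.sum_congr rfl fun j _ => h1 j, Finset.sum_add_distrib, h2, powNum,
    powNum, Finset.mul_sum, Finset.mul_sum, ← Finset.sum_add_distrib, ← Finset.sum_sub_distrib]
  refine Finset.sum_congr rfl fun j _ => ?_
  linear_combination t ^ (k - 2 * j) * s ^ j * powCoeff_succ_index p k j

theorem hasDerivAt_powDeriv (p : ℝ) (k : ℕ) {t s : ℝ} (h : 0 < t ^ 2 + s) :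
    HasDerivAt (fun t => powDeriv p k t s) (powDeriv p (k + 1) t s) t := by
  have h1 : HasDerivAt (fun t => powNum p k t s) (∑ j ∈ Finset.range (k + 1),
      powCoeff p k j * ((k - 2 * j : ℕ) * t ^ (k - 2 * j - 1)) * s ^ j) t := by
    unfold powNum
    refine HasDerivAt.fun_sum fun j _ => ?_
    exact ((hasDerivAt_pow _ t).const_mul _).mul_const _
  have h2 : HasDerivAt (fun t => (t ^ 2 + s) ^ (-(p + k)))
      (2 * t * (-(p + k)) * (t ^ 2 + s) ^ (-(p + k) - 1)) t := by
    simpa using ((hasDerivAt_pow 2 t).add_const s).rpow_const (p := -(p + k)) (Or.inl h.ne')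
  refine (h1.mul h2).congr_deriv ?_
  rw [powDeriv, ← powNum_succ]
  have h3 : (t ^ 2 + s) ^ (-(p + k)) = (t ^ 2 + s) * (t ^ 2 + s) ^ (-(p + (k + 1 : ℕ))) := by
    conv_rhs => enter [1]; rw [← Real.rpow_one (t ^ 2 + s)]
    rw [← Real.rpow_add h]
    congr 1; push_cast; ring
  have h4 : -(p + k) - 1 = -(p + (k + 1 : ℕ)) := by push_cast; ring
  rw [h3, h4]; ring

theorem hasDerivAt_powDeriv_right (p : ℝ) (k : ℕ) {t s : ℝ} (h : 0 < t ^ 2 + s) :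
    HasDerivAt (fun s => powDeriv p k t s) (-p * powDeriv (p + 1) k t s) s := by
  have h1 : HasDerivAt (fun s => powNum p k t s) (∑ j ∈ Finset.range (k + 1),
      powCoeff p k j * t ^ (k - 2 * j) * (j * s ^ (j - 1))) s := by
    unfold powNum
    refine HasDerivAt.fun_sum fun j _ => ?_
    exact (hasDerivAt_pow _ s).const_mul _
  have h2 : HasDerivAt (fun s => (t ^ 2 + s) ^ (-(p + k)))
      ((-(p + k)) * (t ^ 2 + s) ^ (-(p + k) - 1)) s := by
    simpa using ((hasDerivAt_id s).const_add (t ^ 2)).rpow_const (p := -(p + k)) (Or.inl h.ne')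
  refine (h1.mul h2).congr_deriv ?_
  rw [powDeriv, ← mul_assoc (-p), ← powNum_succ_index]
  have h3 : (t ^ 2 + s) ^ (-(p + k)) = (t ^ 2 + s) * (t ^ 2 + s) ^ (-(p + 1 + k)) := by
    conv_rhs => enter [1]; rw [← Real.rpow_one (t ^ 2 + s)]
    rw [← Real.rpow_add h]
    congr 1; ring
  have h4 : -(p + k) - 1 = -(p + 1 + k) := by ring
  rw [h3, h4]; ring

/-- The harmonicity of `(t² + |x|²)^(-p)` on `ℝ^(2p+2)`, differentiated in `t`. -/
theorem powDeriv_harmonic (p : ℝ) {s : ℝ} (hs : 0 ≤ s) : ∀ (k : ℕ) {t : ℝ}, 0 < t →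
    powDeriv p (k + 2) t s = 2 * p * (2 * p + 1) * powDeriv (p + 1) k t s
      - 4 * p * (p + 1) * s * powDeriv (p + 2) k t s
  | 0, t, ht => by
    have h : 0 < t ^ 2 + s := by positivity
    have h3 : (t ^ 2 + s) ^ (-(p + 1)) = (t ^ 2 + s) * (t ^ 2 + s) ^ (-(p + 2)) := by
      conv_rhs => enter [1]; rw [← Real.rpow_one (t ^ 2 + s)]
      rw [← Real.rpow_add h]
      congr 1; ring
    rw [powDeriv_zero, powDeriv_zero, h3]
    simp [powDeriv, powNum, Finset.sum_range_succ, powCoeff]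
    ring
  | k + 1, t, ht => by
    have h : 0 < t ^ 2 + s := by positivity
    -- The identity for `k` holds on the open set t > 0, so both sides have the same `t`-derivative
    -- there, which is the identity for `k + 1`.
    have h1 := hasDerivAt_powDeriv p (k + 2) h
    have h2 := ((hasDerivAt_powDeriv (p + 1) k h).const_mul (2 * p * (2 * p + 1))).sub
      ((hasDerivAt_powDeriv (p + 2) k h).const_mul (4 * p * (p + 1) * s))
    refine h1.unique (h2.congr_of_eventuallyEq ?_)
    filter_upwards [lt_mem_nhds ht] with t ht
    exact powDeriv_harmonic p hs k ht

theorem powDeriv_one (p t s : ℝ) : powDeriv p 1 t s = -(2 * p) * t * (t ^ 2 + s) ^ (-(p + 1)) := by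
  simp [powDeriv, powNum, Finset.sum_range_succ, powCoeff]

/-! ### Closed form of the coefficients and Gegenbauer polynomials. -/

/-- The quotient of Pochhammer symbols and factorials solves the two-term recursion; denominators
are cleared so that the induction is polynomial algebra. -/
theorem powCoeff_eq {p : ℝ} (hp : 0 < p) : ∀ {k j : ℕ}, 2 * j ≤ k →
    powCoeff p k j * (4 ^ j * (ascPochhammer ℝ j).eval (p + 1 / 2) * j ! * (k - 2 * j)!) =
      (-1) ^ (k + j) * (ascPochhammer ℝ k).eval (2 * p) * k !
  | 0, 0, _ => by simp [powCoeff]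
  | 0, j + 1, h => by omega
  | k + 1, 0, _ => by
    have h := powCoeff_eq hp (k := k) (j := 0) (by omega)
    simp only [mul_zero, Nat.sub_zero, pow_zero, ascPochhammer_zero, Polynomial.eval_one,
      Nat.factorial_zero, Nat.cast_one, mul_one, one_mul, add_zero] at h ⊢
    rw [powCoeff, ascPochhammer_succ_eval, Nat.factorial_succ]
    push_cast
    linear_combination (-(k + 2 * p) * (k + 1)) * h
  | k + 1, j + 1, h => by
    have h1 := powCoeff_eq hp (show 2 * j ≤ k by omega)
    rw [powCoeff, ascPochhammer_succ_eval, ascPochhammer_succ_eval, Nat.factorial_succ k]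
    -- On the edge 2(j+1) = k+1 the coefficient of index j+1 at level k is outside the triangle and
    -- vanishes, so one induction hypothesis suffices.
    rcases (by omega : 2 * (j + 1) = k + 1 ∨ 2 * (j + 1) ≤ k) with h' | h'
    · rw [powCoeff_eq_zero p (by omega : k < 2 * (j + 1))]
      obtain rfl : k = 2 * j + 1 := by omega
      rw [show 2 * j + 1 + 1 - 2 * (j + 1) = 0 by omega]
      rw [show 2 * j + 1 - 2 * j = 1 by omega] at h1
      rw [Nat.factorial_succ j]
      push_cast at h1 ⊢
      simp only [Nat.factorial_one, Nat.factorial_zero, Nat.cast_one, mul_one] at h1 ⊢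
      linear_combination (4 * (p + 1 / 2 + j) * (j + 1)) * h1
    · have h2 := powCoeff_eq hp h'
      obtain ⟨n, rfl⟩ : ∃ n, k = 2 * j + 2 + n := ⟨k - 2 * j - 2, by omega⟩
      rw [show 2 * j + 2 + n - 2 * (j + 1) = n by omega, ascPochhammer_succ_eval,
        Nat.factorial_succ j] at h2
      rw [show 2 * j + 2 + n - 2 * j = n + 1 + 1 by omega, Nat.factorial_succ (n + 1),
        Nat.factorial_succ n] at h1
      rw [show 2 * j + 2 + n + 1 - 2 * (j + 1) = n + 1 by omega, Nat.factorial_succ n,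
        Nat.factorial_succ j]
      push_cast at h1 h2 ⊢
      linear_combination (-(2 * j + 2 + n + 2 * p + 2 * (j + 1)) * (n + 1)) * h2 +
        (4 * (p + 1 / 2 + j) * (j + 1)) * h1

/-- The factors of (1-a-n)_i are the negatives of the last i factors of (a)_n. -/
theorem ascPochhammer_eval_neg_sub (a : ℝ) (n : ℕ) : ∀ i : ℕ, i ≤ n →
    (ascPochhammer ℝ i).eval (1 - a - n) * (ascPochhammer ℝ (n - i)).eval a =
      (-1) ^ i * (ascPochhammer ℝ n).eval a
  | 0, _ => by simp
  | i + 1, h => by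
    have h1 := ascPochhammer_eval_neg_sub a n i (by omega)
    obtain ⟨l, rfl⟩ : ∃ l, n = i + 1 + l := ⟨n - i - 1, by omega⟩
    rw [show i + 1 + l - i = l + 1 by omega, ascPochhammer_succ_eval] at h1
    rw [show i + 1 + l - (i + 1) = l by omega, ascPochhammer_succ_eval, pow_succ]
    push_cast at h1 ⊢
    linear_combination -h1

/-- The Gegenbauer polynomials `C_k^{1/2-p-k}` at imaginary arguments. -/
theorem aeval_gegenbauer {p : ℝ} (hp : 0 < p) (k : ℕ) (t : ℝ) {r : ℝ} (hr : r ≠ 0) :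
    ((ascPochhammer ℝ k).eval (2 * p) * k ! : ℝ) * ((r ^ k : ℝ) * Complex.I ^ k *
      Polynomial.aeval (Complex.I * ((t / r : ℝ) : ℂ)) (gegenbauer k (1 / 2 - p - k))) =
      ((-1) ^ k * 2 ^ k * (ascPochhammer ℝ k).eval (p + 1 / 2) * powNum p k t (r ^ 2) : ℝ) := by
  have hN : powNum p k t (r ^ 2) = ∑ j ∈ Finset.range (k / 2 + 1),
      powCoeff p k j * t ^ (k - 2 * j) * (r ^ 2) ^ j := by
    refine (Finset.sum_subset (Finset.range_subset_range.2 (by omega)) fun j _ hj => ?_).symm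
    rw [powCoeff_eq_zero p (by simp at hj; omega)]; ring
  rw [hN, gegenbauer, map_sum, Finset.mul_sum, Finset.mul_sum, Finset.mul_sum, Complex.ofReal_sum]
  refine Finset.sum_congr rfl fun j hj => ?_
  have hj : 2 * j ≤ k := by simp at hj; omega
  obtain ⟨n, rfl⟩ : ∃ n, k = 2 * j + n := ⟨k - 2 * j, by omega⟩
  have h1 := powCoeff_eq hp hj
  -- With a = p + 1/2 the Gegenbauer parameter is 1 - a - k, so the reflection turns (1/2-p-k)_{k-j}
  -- into ±(a)_k/(a)_j, which carries the denominator (a)_j of `powCoeff_eq`.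
  have h2 := ascPochhammer_eval_neg_sub (p + 1 / 2) (2 * j + n) (j + n) (by omega)
  rw [show (1 : ℝ) - (p + 1 / 2) - (2 * j + n : ℕ) = 1 / 2 - p - (2 * j + n : ℕ) by ring,
    show 2 * j + n - (j + n) = j by omega] at h2
  rw [show 2 * j + n - j = j + n by omega]
  rw [show 2 * j + n - 2 * j = n by omega] at h1 ⊢
  -- The prefactor i^k makes every term real, since k and k - 2j have the same parity.
  have hI : Complex.I ^ (2 * j + n) * Complex.I ^ n = (-1) ^ (j + n) := by
    rw [← Complex.I_sq, ← pow_mul, ← pow_add]; congr 1; ring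
  have hpos : (0 : ℝ) < (ascPochhammer ℝ j).eval (p + 1 / 2) := ascPochhammer_pos j _ (by positivity)
  simp only [map_mul, map_pow, Polynomial.aeval_C, Polynomial.aeval_X, map_ofNat]
  generalize (ascPochhammer ℝ (2 * j + n)).eval (p + 1 / 2) = P at *
  generalize (ascPochhammer ℝ j).eval (p + 1 / 2) = Q at *
  generalize (ascPochhammer ℝ (j + n)).eval (1 / 2 - p - (2 * j + n : ℕ)) = R at *
  generalize (ascPochhammer ℝ (2 * j + n)).eval (2 * p) = S at *
  have hc : powCoeff p (2 * j + n) j =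
      (-1) ^ (2 * j + n + j) * S * (2 * j + n)! / (4 ^ j * Q * j ! * n !) := by
    rw [eq_div_iff (by positivity), h1]
  have hR : R = (-1) ^ (j + n) * P / Q := by rw [eq_div_iff hpos.ne', h2]
  have h4 : (4 : ℂ) ^ j = 2 ^ (2 * j) := by rw [pow_mul]; norm_num
  rw [hc, hR, mul_pow, mul_pow, Complex.coe_algebraMap]
  push_cast
  have e1 : ((-1 : ℂ) ^ (j + n)) * (-1) ^ (j + n) = 1 := by rw [← mul_pow]; simp
  have e2 : ((-1 : ℂ) ^ (2 * j + n)) * (-1) ^ (2 * j + n) = 1 := by rw [← mul_pow]; simp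
  have hr' : (r : ℂ) ≠ 0 := by exact_mod_cast hr
  have hQ : (Q : ℂ) ≠ 0 := by exact_mod_cast hpos.ne'
  have hf1 : (j ! : ℂ) ≠ 0 := by exact_mod_cast j.factorial_ne_zero
  have hf2 : (n ! : ℂ) ≠ 0 := by exact_mod_cast n.factorial_ne_zero
  rw [h4, div_pow]
  field_simp
  linear_combination (S * (2 * j + n)! * r ^ (2 * j + n) * (-1) ^ j * (-1) ^ (j + n) * P * 2 ^ n *
      t ^ n * 2 ^ (2 * j) : ℂ) * hI +
    (S * (2 * j + n)! * r ^ (2 * j + n) * (-1) ^ j * P * 2 ^ n * t ^ n * 2 ^ (2 * j) : ℂ) * e1 -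
    (S * (2 * j + n)! * r ^ (2 * j + n) * (-1) ^ j * P * 2 ^ n * t ^ n * 2 ^ (2 * j) : ℂ) * e2

end HalfSpace
end

noncomputable section

namespace HalfSpace

variable {m : ℕ}

/-! ### Clifford algebra -/

theorem e_mul_self (m : ℕ) (i : Fin (m + 1)) : e m i * e m i = -1 := by
  rw [e, CliffordAlgebra.ι_sq_scalar, QuadraticMap.weightedSumSquares_apply,
    Finset.sum_eq_single i]
  · simp
  · intro j _ hj; simp [hj]
  · simp

theorem e_mul_e {i j : Fin (m + 1)} (h : i ≠ j) : e m i * e m j = -(e m j * e m i) := by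
  rw [eq_neg_iff_add_eq_zero, e, e, CliffordAlgebra.ι_mul_ι_add_swap]
  have : QuadraticMap.polar (negForm m) (Pi.single i 1) (Pi.single j 1) = 0 := by
    simp only [QuadraticMap.polar, QuadraticMap.weightedSumSquares_apply, Pi.add_apply, smul_eq_mul]
    rw [← Finset.sum_sub_distrib, ← Finset.sum_sub_distrib]
    refine Finset.sum_eq_zero fun l _ => ?_
    rcases eq_or_ne l i with rfl | hi
    · simp [h]
    · simp [hi]
  rw [this, map_zero]

theorem ebar0_eq (m : ℕ) : ebar0 m = -e m 0 := CliffordAlgebra.star_ι _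

/-- The vector variable as a linear map. -/
def vecCLM (m : ℕ) : E m →L[ℝ] Cl m :=
  LinearMap.toContinuousLinearMap
    { toFun := vec
      map_add' := fun x y => by simp [vec, add_smul, Finset.sum_add_distrib]
      map_smul' := fun c x => by simp [vec, mul_smul, Finset.smul_sum] }

@[simp] theorem vecCLM_apply (x : E m) : vecCLM m x = vec x := rfl

theorem vec_single (j : Fin m) : vec (EuclideanSpace.single j (1 : ℝ)) = e m j.succ := by
  rw [vec, Finset.sum_eq_single j]
  · simp
  · intro i _ hi; simp [hi]
  · simp

theorem e0_mul_vec (x : E m) : e m 0 * vec x = -(vec x * e m 0) := by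
  simp only [vec, Finset.mul_sum, Finset.sum_mul, ← Finset.sum_neg_distrib]
  refine Finset.sum_congr rfl fun j _ => ?_
  rw [mul_smul_comm, smul_mul_assoc, e_mul_e (Fin.succ_ne_zero j).symm, smul_neg]

theorem vec_mul_self (x : E m) : vec x * vec x = -(‖x‖ ^ 2) • (1 : Cl m) := by
  have h : vec x = CliffordAlgebra.ι (negForm m) (Fin.cons 0 x) := by
    have : (Fin.cons 0 x : Fin (m + 1) → ℝ) =
        ∑ j : Fin m, x j • (Pi.single j.succ 1 : Fin (m + 1) → ℝ) := by
      ext i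
      rw [Finset.sum_apply]
      refine Fin.cases ?_ (fun i => ?_) i
      · simp
      · rw [Finset.sum_eq_single i]
        · simp
        · intro j _ hj; simp [hj.symm]
        · simp
    rw [this, map_sum]
    simp only [map_smul]
    rfl
  rw [h, CliffordAlgebra.ι_sq_scalar, QuadraticMap.weightedSumSquares_apply, Fin.sum_univ_succ,
    Algebra.algebraMap_eq_smul_one, EuclideanSpace.norm_sq_eq]
  simp [pow_two]

theorem sum_e_mul_e (m : ℕ) : ∑ j : Fin m, e m j.succ * e m j.succ = -(m : ℝ) • (1 : Cl m) := by
  simp [e_mul_self, ← Nat.cast_smul_eq_nsmul ℝ]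

theorem vec_mem_subCl (x : E m) : vec x ∈ subCl m :=
  sum_mem fun j _ => Subalgebra.smul_mem _ (Algebra.subset_adjoin (Set.mem_range_self j)) _

theorem flip0_smul_one (a : ℝ) : flip0 (a • (1 : Cl m)) = a • 1 := by
  simp [flip0, ebar0_eq, e_mul_self]

theorem involute_vec (x : E m) : CliffordAlgebra.involute (vec x) = -vec x := by
  simp only [vec, map_sum, map_smul, e, CliffordAlgebra.involute_ι, smul_neg,
    Finset.sum_neg_distrib]

/-- The product is even, so the grade involution fixes it, and e₀ anticommutes with it. With
`flip0_smul_one` this separates the two components of the potentials. -/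
theorem flip0_ebar0_mul_vec (x : E m) : flip0 (ebar0 m * vec x) = -(ebar0 m * vec x) := by
  have h : CliffordAlgebra.involute (ebar0 m * vec x) = ebar0 m * vec x := by
    rw [map_mul, involute_vec, ebar0_eq, map_neg, e, CliffordAlgebra.involute_ι]
    simp
  rw [flip0, h, ebar0_eq]
  calc -e m 0 * (-e m 0 * vec x) * e m 0 = (e m 0 * e m 0) * (vec x * e m 0) := by noncomm_ring
    _ = -(vec x * e m 0) := by rw [e_mul_self]; simp
    _ = - (-e m 0 * vec x) := by rw [← e0_mul_vec]; simp

theorem flip0_add (a b : Cl m) : flip0 (a + b) = flip0 a + flip0 b := by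
  simp [flip0, mul_add, add_mul]

theorem flip0_smul (c : ℝ) (a : Cl m) : flip0 (c • a) = c • flip0 a := by
  simp [flip0]

theorem realPart_eq (a b : ℝ) (x : E m) :
    realPart (a • (1 : Cl m) + ebar0 m * (b • vec x)) = a • (1 : Cl m) := by
  rw [realPart, flip0_add, flip0_smul_one, mul_smul_comm, flip0_smul, flip0_ebar0_mul_vec]
  module

theorem imagPart_eq (a b : ℝ) (x : E m) :
    imagPart (a • (1 : Cl m) + ebar0 m * (b • vec x)) = b • vec x := by
  rw [imagPart, flip0_add, flip0_smul_one, mul_smul_comm, flip0_smul, flip0_ebar0_mul_vec,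
    smul_neg, add_sub_add_left_eq_sub, sub_neg_eq_add, ← two_smul ℝ, mul_smul_comm, smul_smul,
    ebar0_eq, mul_smul_comm, neg_mul, mul_neg, ← mul_assoc, e_mul_self]
  simp

/-! ### Radial functions and the Dirac operator -/

/-- Radial functions are written in |x|² rather than |x|, so that the origin needs no separate
treatment. -/
theorem hasFDerivAt_comp_norm_sq {V : Type*} [NormedAddCommGroup V] [NormedSpace ℝ V]
    {g : ℝ → V} {g' : V} {x : E m} (h : HasDerivAt g g' (‖x‖ ^ 2)) :
    HasFDerivAt (fun x : E m => g (‖x‖ ^ 2)) ((2 • innerSL ℝ x).smulRight g') x :=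
  h.hasFDerivAt.comp x (hasStrictFDerivAt_norm_sq x).hasFDerivAt |>.congr_fderiv <| by
    ext v; simp [add_smul, two_smul]

theorem hasLineDerivAt_radial {g : ℝ → ℝ} {g' : ℝ} {x : E m} (h : HasDerivAt g g' (‖x‖ ^ 2))
    (j : Fin m) : HasLineDerivAt ℝ (fun x : E m => g (‖x‖ ^ 2)) (2 * x j * g') x
      (EuclideanSpace.single j 1) := by
  have h1 := (hasFDerivAt_comp_norm_sq h).hasLineDerivAt (EuclideanSpace.single j 1)
  have h2 : ((2 • innerSL ℝ x).smulRight g') (EuclideanSpace.single j 1) = 2 * x j * g' := by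
    simp [EuclideanSpace.inner_eq_star_dotProduct]
  rwa [h2] at h1

theorem hasLineDerivAt_radial_one {g : ℝ → ℝ} {g' : ℝ} {x : E m} (h : HasDerivAt g g' (‖x‖ ^ 2))
    (j : Fin m) : HasLineDerivAt ℝ (fun x : E m => g (‖x‖ ^ 2) • (1 : Cl m))
      ((2 * x j * g') • (1 : Cl m)) x (EuclideanSpace.single j 1) :=
  HasDerivAt.smul_const (hasLineDerivAt_radial h j) 1

theorem hasLineDerivAt_radial_vec {g : ℝ → ℝ} {g' : ℝ} {x : E m} (h : HasDerivAt g g' (‖x‖ ^ 2))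
    (j : Fin m) : HasLineDerivAt ℝ (fun x : E m => g (‖x‖ ^ 2) • vec x)
      (g (‖x‖ ^ 2) • e m j.succ + (2 * x j * g') • vec x) x (EuclideanSpace.single j 1) := by
  have h2 : HasLineDerivAt ℝ (vecCLM m) (vecCLM m (EuclideanSpace.single j 1)) x
    (EuclideanSpace.single j 1) := (vecCLM m).hasFDerivAt.hasLineDerivAt _
  have h3 := HasDerivAt.smul (hasLineDerivAt_radial h j) h2
  refine HasDerivAt.congr_deriv (f := fun t => g (‖x + t • _‖ ^ 2) • vec (x + t • _)) h3 ?_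
  simp [vec_single]

theorem dirac_eq {f : E m → Cl m} {x : E m} {f' : Fin m → Cl m}
    (h : ∀ j, HasLineDerivAt ℝ f (f' j) x (EuclideanSpace.single j 1)) :
    dirac f x = ∑ j, e m j.succ * f' j := by
  simp only [dirac, fun j => (h j).lineDeriv]

theorem sum_e_mul_radial_one (x : E m) (g' : ℝ) :
    ∑ j, e m j.succ * ((2 * x j * g') • (1 : Cl m)) = (2 * g') • vec x := by
  rw [vec, Finset.smul_sum]
  refine Finset.sum_congr rfl fun j _ => ?_
  rw [mul_smul_comm, mul_one, smul_smul]; congr 1; ring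

/-- The squares e_j² = -1 contribute -m g, and the derivative of g contributes 2g' x² = -2|x|² g'.
-/
theorem sum_e_mul_radial_vec (x : E m) (g g' : ℝ) :
    ∑ j, e m j.succ * (g • e m j.succ + (2 * x j * g') • vec x) =
      -(m * g + 2 * ‖x‖ ^ 2 * g') • (1 : Cl m) := by
  have h : ∀ j, e m j.succ * ((2 * x j * g') • vec x) =
      e m j.succ * ((2 * x j * g') • 1) * vec x := by simp
  simp only [mul_add, Finset.sum_add_distrib, h]
  rw [← Finset.sum_mul, sum_e_mul_radial_one, smul_mul_assoc, vec_mul_self]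
  simp only [mul_smul_comm, ← Finset.smul_sum, sum_e_mul_e, smul_smul]
  rw [← add_smul]; congr 1; ring

theorem dirac_radial_one {g : ℝ → ℝ} {g' : ℝ} {x : E m} (h : HasDerivAt g g' (‖x‖ ^ 2)) :
    dirac (fun x : E m => g (‖x‖ ^ 2) • (1 : Cl m)) x = (2 * g') • vec x := by
  rw [dirac_eq (hasLineDerivAt_radial_one h), sum_e_mul_radial_one]

theorem dirac_radial_vec {g : ℝ → ℝ} {g' : ℝ} {x : E m} (h : HasDerivAt g g' (‖x‖ ^ 2)) :
    dirac (fun x : E m => g (‖x‖ ^ 2) • vec x) x =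
      -(m * g (‖x‖ ^ 2) + 2 * ‖x‖ ^ 2 * g') • (1 : Cl m) := by
  rw [dirac_eq (hasLineDerivAt_radial_vec h), sum_e_mul_radial_vec]

/-! ### The potentials -/

/-- Half the exponent of the fundamental solution of the Laplace operator in `ℝ^{m+1}`. -/
def halfExp (m : ℕ) : ℝ := (m - 1) / 2

/-- The real potential `A_{-k}`; for `k = 0` it is a potential of `A_{-1}` and `B_{-1}`. -/
def potA (m k : ℕ) (t : ℝ) (x : E m) : Cl m :=
  (-(1 / (sphereArea (m + 1) * halfExp m)) * powDeriv (halfExp m) k t (‖x‖ ^ 2)) • 1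

/-- The vector potential `B_{-k-1}`. -/
def potB (m k : ℕ) (t : ℝ) (x : E m) : Cl m :=
  (-(2 / sphereArea (m + 1)) * powDeriv (halfExp m + 1) k t (‖x‖ ^ 2)) • vec x

theorem sphereArea_pos {n : ℕ} (hn : 0 < n) : 0 < sphereArea n := by
  have := Real.Gamma_pos_of_pos (show (0 : ℝ) < n / 2 by positivity)
  have := Real.pi_pos
  unfold sphereArea; positivity

theorem halfExp_pos (hm : 2 ≤ m) : 0 < halfExp m := by
  have : (2 : ℝ) ≤ m := by exact_mod_cast hm
  unfold halfExp; linarith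

theorem hasDerivAt_potA (k : ℕ) {t : ℝ} (ht : 0 < t) (x : E m) :
    HasDerivAt (fun t => potA m k t x) (potA m (k + 1) t x) t :=
  ((hasDerivAt_powDeriv _ k (by positivity)).const_mul _).smul_const _

theorem hasDerivAt_potB (k : ℕ) {t : ℝ} (ht : 0 < t) (x : E m) :
    HasDerivAt (fun t => potB m k t x) (potB m (k + 1) t x) t :=
  ((hasDerivAt_powDeriv _ k (by positivity)).const_mul _).smul_const _

theorem dirac_potA (hm : 2 ≤ m) (k : ℕ) {t : ℝ} (ht : 0 < t) (x : E m) :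
    dirac (potA m k t) x = -potB m k t x := by
  have hp := halfExp_pos hm
  have hσ := sphereArea_pos (Nat.succ_pos m)
  have h := (hasDerivAt_powDeriv_right (halfExp m) k (by positivity : 0 < t ^ 2 + ‖x‖ ^ 2)).const_mul
    (-(1 / (sphereArea (m + 1) * halfExp m)))
  rw [potB, ← neg_smul]
  refine (dirac_radial_one h).trans ?_
  congr 1
  field_simp

theorem dirac_potB (hm : 2 ≤ m) (k : ℕ) {t : ℝ} (ht : 0 < t) (x : E m) :
    dirac (potB m k t) x = -potA m (k + 2) t x := by
  have hp := halfExp_pos hm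
  have hσ := sphereArea_pos (Nat.succ_pos m)
  have h := (hasDerivAt_powDeriv_right (halfExp m + 1) k
    (by positivity : 0 < t ^ 2 + ‖x‖ ^ 2)).const_mul (-(2 / sphereArea (m + 1)))
  -- Here harmonicity enters: the right-hand side of `powDeriv_harmonic` is, up to a constant, the
  -- Dirac derivative of the vector potential, because m = 2p + 1.
  rw [potA, ← neg_smul, powDeriv_harmonic _ (by positivity) k ht]
  refine (dirac_radial_vec h).trans ?_
  congr 1
  have hm' : (m : ℝ) = 2 * halfExp m + 1 := by unfold halfExp; ring
  rw [hm', show halfExp m + 1 + 1 = halfExp m + 2 by ring]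
  field_simp
  ring

theorem differentiableAt_potA (k : ℕ) {t : ℝ} (ht : 0 < t) (x : E m) (j : Fin m) :
    ∃ a, HasLineDerivAt ℝ (potA m k t) a x (EuclideanSpace.single j 1) :=
  ⟨_, hasLineDerivAt_radial_one ((hasDerivAt_powDeriv_right (halfExp m) k
    (by positivity : 0 < t ^ 2 + ‖x‖ ^ 2)).const_mul _) j⟩

theorem differentiableAt_potB (k : ℕ) {t : ℝ} (ht : 0 < t) (x : E m) (j : Fin m) :
    ∃ a, HasLineDerivAt ℝ (potB m k t) a x (EuclideanSpace.single j 1) :=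
  ⟨_, hasLineDerivAt_radial_vec ((hasDerivAt_powDeriv_right (halfExp m + 1) k
    (by positivity : 0 < t ^ 2 + ‖x‖ ^ 2)).const_mul _) j⟩

theorem cauchyKernel_eq (hm : 2 ≤ m) {t : ℝ} (ht : 0 < t) (x : E m) :
    cauchyKernel m t x = (1 / 2 : ℝ) • potA m 1 t x + (1 / 2 : ℝ) • (ebar0 m * potB m 0 t x) := by
  have hp := halfExp_pos hm
  have hσ := sphereArea_pos (Nat.succ_pos m)
  have h : 0 < t ^ 2 + ‖x‖ ^ 2 := by positivity
  have h1 : (t • e m 0 + vec x) * ebar0 m = t • 1 + (-1 : ℝ) • (ebar0 m * vec x) := by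
    rw [ebar0_eq, add_mul, mul_neg, neg_mul, e0_mul_vec, smul_mul_assoc, e_mul_self]
    simp
  have h2 : (t ^ 2 + ‖x‖ ^ 2) ^ (-(halfExp m + 1)) = (Real.sqrt (t ^ 2 + ‖x‖ ^ 2) ^ (m + 1))⁻¹ := by
    rw [Real.sqrt_eq_rpow, ← Real.rpow_natCast _ (m + 1), ← Real.rpow_mul h.le, ← Real.rpow_neg h.le]
    congr 1; unfold halfExp; push_cast; ring
  rw [cauchyKernel, h1, potA, potB, powDeriv_one, powDeriv_zero, h2, mul_smul_comm, smul_smul,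
    smul_smul, smul_add, smul_smul, smul_smul]
  have h3 : Real.sqrt (t ^ 2 + ‖x‖ ^ 2) ≠ 0 := (Real.sqrt_pos.2 h).ne'
  congr 2 <;> field_simp

/-- By the relations for ∂ on `potA` and `potB`, the two terms ½∂_{x₀} and -½ē₀∂ contribute the same
amount, so the outer factor ½ is compensated. -/
theorem C_succ_eq (hm : 2 ≤ m) : ∀ (k : ℕ) {t : ℝ}, 0 < t → ∀ x : E m, C m (k + 1) t x =
    (1 / 2 : ℝ) • potA m (k + 1) t x + (1 / 2 : ℝ) • (ebar0 m * potB m k t x)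
  | 0, t, ht, x => by simpa [C] using cauchyKernel_eq hm ht x
  | k + 1, t, ht, x => by
    have hC : C m (k + 1 + 1) t x = crBar (C m (k + 1)) t x := by
      simp only [C, Nat.add_sub_cancel]
      rw [Function.iterate_succ_apply']
    let L : Cl m →L[ℝ] Cl m := LinearMap.toContinuousLinearMap (LinearMap.mulLeft ℝ (ebar0 m))
    have hL : ∀ a, L a = ebar0 m * a := fun a => rfl
    have h0 : partial0 (C m (k + 1)) t x =
        (1 / 2 : ℝ) • potA m (k + 2) t x + (1 / 2 : ℝ) • (ebar0 m * potB m (k + 1) t x) := by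
      have h := ((hasDerivAt_potA (k + 1) ht x).const_smul (1 / 2 : ℝ)).add
        ((L.hasFDerivAt.comp_hasDerivAt t (hasDerivAt_potB k ht x)).const_smul (1 / 2 : ℝ))
      refine (h.congr_of_eventuallyEq ?_).deriv
      filter_upwards [lt_mem_nhds ht] with s hs
      exact C_succ_eq hm k hs x
    have h1 : dirac (C m (k + 1) t) x =
        (1 / 2 : ℝ) • dirac (potA m (k + 1) t) x -
          (1 / 2 : ℝ) • (ebar0 m * dirac (potB m k t) x) := by
      choose a ha using differentiableAt_potA (k + 1) ht x
      choose b hb using differentiableAt_potB k ht x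
      have h : ∀ j, HasLineDerivAt ℝ (C m (k + 1) t) ((1 / 2 : ℝ) • a j + (1 / 2 : ℝ) • L (b j)) x
          (EuclideanSpace.single j 1) := by
        intro j
        rw [funext fun x => C_succ_eq hm k ht x]
        exact ((ha j).const_smul (1 / 2 : ℝ)).add
          ((L.hasFDerivAt.comp_hasDerivAt _ (hb j)).const_smul (1 / 2 : ℝ))
      rw [dirac_eq h, dirac_eq ha, dirac_eq hb, Finset.mul_sum, Finset.smul_sum, Finset.smul_sum,
        ← Finset.sum_sub_distrib]
      refine Finset.sum_congr rfl fun j _ => ?_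
      rw [hL, mul_add, mul_smul_comm, mul_smul_comm, sub_eq_add_neg, ← smul_neg, ← mul_assoc,
        ← mul_assoc, ← neg_mul, ebar0_eq]
      congr 3
      -- Moving e_j past ē₀ produces the minus sign in `h1`.
      rw [mul_neg, neg_mul, neg_neg, e_mul_e (Fin.succ_ne_zero j), neg_neg]
    have h2 : ∀ a : Cl m, ebar0 m * (ebar0 m * a) = -a := fun a => by
      rw [← mul_assoc, ebar0_eq, neg_mul_neg, e_mul_self, neg_one_mul]
    rw [hC, crBar, h0, h1, dirac_potA hm _ ht, dirac_potB hm _ ht, mul_sub, mul_smul_comm,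
      mul_smul_comm, h2]
    simp only [mul_neg, smul_neg, neg_neg]
    module

theorem A_succ_eq (hm : 2 ≤ m) (k : ℕ) {t : ℝ} (ht : 0 < t) (x : E m) :
    A m (k + 1) t x = potA m (k + 1) t x := by
  rw [A, C_succ_eq hm k ht, potA, potB, smul_smul, ← mul_smul_comm, smul_smul, realPart_eq,
    smul_smul]
  congr 1; ring

theorem B_succ_eq (hm : 2 ≤ m) (k : ℕ) {t : ℝ} (ht : 0 < t) (x : E m) :
    B m (k + 1) t x = potB m k t x := by
  rw [B, C_succ_eq hm k ht, potA, potB, smul_smul, ← mul_smul_comm, smul_smul, imagPart_eq,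
    smul_smul]
  congr 1; ring

theorem continuousOn_powDeriv (p : ℝ) (k : ℕ) : ContinuousOn
    (fun q : ℝ × E m => powDeriv p k q.1 (‖q.2‖ ^ 2)) {q | 0 < q.1} := by
  unfold powDeriv powNum
  refine ContinuousOn.mul (by fun_prop) (ContinuousOn.rpow_const (by fun_prop) fun q hq => ?_)
  have : 0 < q.1 := hq
  exact Or.inl (by positivity)

theorem continuousOn_potA (k : ℕ) :
    ContinuousOn (fun q : ℝ × E m => potA m k q.1 q.2) {q | 0 < q.1} := by
  unfold potA
  have := continuousOn_powDeriv (m := m) (halfExp m) k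
  fun_prop

theorem continuousOn_potB (k : ℕ) :
    ContinuousOn (fun q : ℝ × E m => potB m k q.1 q.2) {q | 0 < q.1} :=
  (continuousOn_const.mul (continuousOn_powDeriv (halfExp m + 1) k)).smul
    ((vecCLM m).continuous.comp continuous_snd).continuousOn

theorem contDiff_powDeriv (p : ℝ) (k : ℕ) {t : ℝ} (ht : 0 < t) :
    ContDiff ℝ 1 (fun x : E m => powDeriv p k t (‖x‖ ^ 2)) := by
  unfold powDeriv powNum
  have h : ContDiff ℝ 1 fun x : E m => ‖x‖ ^ 2 := contDiff_norm_sq ℝ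
  refine ContDiff.mul (ContDiff.sum fun j _ => contDiff_const.mul (h.pow j)) ?_
  exact (contDiff_const.add h).rpow_const_of_ne fun x => by positivity

theorem contDiff_potA (k : ℕ) {t : ℝ} (ht : 0 < t) : ContDiff ℝ 1 (potA m k t) :=
  ContDiff.smul (contDiff_const.mul (contDiff_powDeriv (halfExp m) k ht))
    (contDiff_const (c := (1 : Cl m)))

theorem contDiff_potB (k : ℕ) {t : ℝ} (ht : 0 < t) : ContDiff ℝ 1 (potB m k t) :=
  (contDiff_const.mul (contDiff_powDeriv (halfExp m + 1) k ht)).smul (vecCLM m).contDiff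

/-- The decomposition of the downstream potentials and the relations between them. -/
theorem potentials_decomposition (hm : 2 ≤ m) (k : ℕ) :
    ContinuousOn (fun p : ℝ × E m => A m (k + 1) p.1 p.2) {p | 0 < p.1} ∧
    ContinuousOn (fun p : ℝ × E m => B m (k + 1) p.1 p.2) {p | 0 < p.1} ∧
    ∀ x₀ : ℝ, 0 < x₀ → ∀ x : E m,
      A m (k + 1) x₀ x ∈ subCl m ∧ B m (k + 1) x₀ x ∈ subCl m ∧
      C m (k + 1) x₀ x = (1 / 2 : ℝ) • A m (k + 1) x₀ x +
        (1 / 2 : ℝ) • (ebar0 m * B m (k + 1) x₀ x) ∧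
      A m (k + 1 + 1) x₀ x = partial0 (A m (k + 1)) x₀ x ∧
      A m (k + 1 + 1) x₀ x = -dirac (B m (k + 1) x₀) x ∧
      B m (k + 1 + 1) x₀ x = partial0 (B m (k + 1)) x₀ x ∧
      B m (k + 1 + 1) x₀ x = -dirac (A m (k + 1) x₀) x := by
  refine ⟨(continuousOn_potA (k + 1)).congr fun q hq => A_succ_eq hm k hq q.2,
    (continuousOn_potB k).congr fun q hq => B_succ_eq hm k hq q.2, fun t ht x => ?_⟩
  have hA : A m (k + 1) t = potA m (k + 1) t := funext fun x => A_succ_eq hm k ht x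
  have hB : B m (k + 1) t = potB m k t := funext fun x => B_succ_eq hm k ht x
  rw [A_succ_eq hm (k + 1) ht, B_succ_eq hm (k + 1) ht, hA, hB, dirac_potA hm _ ht,
    dirac_potB hm _ ht, neg_neg, neg_neg]
  refine ⟨Subalgebra.smul_mem _ (one_mem _) _, Subalgebra.smul_mem _ (vec_mem_subCl x) _,
    C_succ_eq hm k ht x, ?_, rfl, ?_, rfl⟩
  · refine ((hasDerivAt_potA (k + 1) ht x).congr_of_eventuallyEq ?_).deriv.symm
    filter_upwards [lt_mem_nhds ht] with s hs using A_succ_eq hm k hs x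
  · refine ((hasDerivAt_potB k ht x).congr_of_eventuallyEq ?_).deriv.symm
    filter_upwards [lt_mem_nhds ht] with s hs using B_succ_eq hm k hs x

end HalfSpace
end

noncomputable section

namespace HalfSpace

/-! ### Gegenbauer formulas -/

theorem prod_Icc_mul_factorial (a : ℕ) : ∀ n : ℕ,
    (∏ i ∈ Finset.Icc (a + 1) (a + n), (i : ℂ)) * a ! = (a + n)!
  | 0 => by simp
  | n + 1 => by
    rw [← add_assoc, Finset.prod_Icc_succ_top (by omega), mul_right_comm,
      prod_Icc_mul_factorial a n, Nat.factorial_succ]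
    push_cast; ring

theorem prod_Icc_odd (n : ℕ) :
    (∏ i ∈ Finset.Icc 1 n, (2 * i - 1 : ℂ)) * (2 ^ n * n !) = (2 * n)! := by
  induction n with
  | zero => simp
  | succ n ih =>
    rw [Finset.prod_Icc_succ_top (by omega), Nat.factorial_succ n,
      show 2 * (n + 1) = 2 * n + 1 + 1 by ring, Nat.factorial_succ, Nat.factorial_succ]
    push_cast
    rw [← ih]; ring

theorem prod_Icc_two_odd (n : ℕ) : ∏ i ∈ Finset.Icc 2 (n + 1), (2 * i - 1 : ℂ) =
    ∏ i ∈ Finset.Icc 1 (n + 1), (2 * i - 1 : ℂ) := by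
  rw [← Finset.prod_Ioc_mul_eq_prod_Icc (show 1 ≤ n + 1 by omega)]
  norm_num
  rfl

theorem ascPochhammer_two_eval (n : ℕ) : (ascPochhammer ℝ n).eval 2 = (n + 1)! := by
  induction n with
  | zero => simp
  | succ n ih => rw [ascPochhammer_succ_eval, ih, Nat.factorial_succ (n + 1)]; push_cast; ring

theorem ascPochhammer_three_eval (n : ℕ) : (ascPochhammer ℝ n).eval 3 = (n + 2)! / 2 := by
  induction n with
  | zero => simp
  | succ n ih => rw [ascPochhammer_succ_eval, ih, Nat.factorial_succ (n + 2)]; push_cast; ring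

theorem ascPochhammer_four_eval (n : ℕ) : (ascPochhammer ℝ n).eval 4 = (n + 3)! / 6 := by
  induction n with
  | zero => norm_num [Nat.factorial]
  | succ n ih => rw [ascPochhammer_succ_eval, ih, Nat.factorial_succ (n + 3)]; push_cast; ring

theorem ascPochhammer_three_halves_eval (n : ℕ) :
    (ascPochhammer ℝ n).eval (3 / 2) * (4 ^ n * n !) = (2 * n + 1)! := by
  induction n with
  | zero => simp
  | succ n ih =>
    rw [ascPochhammer_succ_eval, Nat.factorial_succ n,
      show 2 * (n + 1) + 1 = 2 * n + 1 + 1 + 1 by ring, Nat.factorial_succ (2 * n + 1 + 1),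
      Nat.factorial_succ (2 * n + 1)]
    push_cast
    rw [← ih]; ring

theorem ascPochhammer_five_halves_eval (n : ℕ) :
    (ascPochhammer ℝ n).eval (5 / 2) * (4 ^ n * n ! * (6 * (n + 1))) = (2 * n + 3)! := by
  induction n with
  | zero => norm_num [Nat.factorial]
  | succ n ih =>
    rw [ascPochhammer_succ_eval, Nat.factorial_succ n,
      show 2 * (n + 1) + 3 = 2 * n + 3 + 1 + 1 by ring, Nat.factorial_succ (2 * n + 3 + 1),
      Nat.factorial_succ (2 * n + 3)]
    push_cast
    rw [← ih]; ring

theorem sphereArea_three : sphereArea 3 = 4 * Real.pi := by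
  have h : Real.Gamma ((3 : ℕ) / 2) = Real.sqrt Real.pi / 2 := by
    rw [show (((3 : ℕ) : ℝ) / 2) = 1 / 2 + 1 by norm_num, Real.Gamma_add_one (by norm_num),
      Real.Gamma_one_half_eq]; ring
  have h2 : Real.pi ^ (((3 : ℕ) : ℝ) / 2) = Real.pi * Real.sqrt Real.pi := by
    rw [show (((3 : ℕ) : ℝ) / 2) = 1 + 1 / 2 by norm_num, Real.rpow_add Real.pi_pos, Real.rpow_one,
      Real.sqrt_eq_rpow]
  have h3 : Real.sqrt Real.pi ≠ 0 := (Real.sqrt_pos.2 Real.pi_pos).ne'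
  rw [sphereArea, h, h2]; field_simp; norm_num

theorem sphereArea_four : sphereArea 4 = 2 * Real.pi ^ 2 := by
  have h : Real.Gamma ((4 : ℕ) / 2) = 1 := by
    rw [show (((4 : ℕ) : ℝ) / 2) = 2 by norm_num]; exact Real.Gamma_two
  rw [sphereArea, h, show (((4 : ℕ) : ℝ) / 2) = (2 : ℕ) by norm_num, Real.rpow_natCast, div_one]

theorem halfExp_two : halfExp 2 = 1 / 2 := by norm_num [halfExp]

theorem halfExp_three : halfExp 3 = 1 := by norm_num [halfExp]

theorem neg_one_pow_mul_self (n : ℕ) : (-1 : ℂ) ^ n * (-1) ^ n = 1 := by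
  rw [← mul_pow]; simp

/-- Common to the four formulas: what is left for each is the identity `hw` between constants, with
`c` the constant of the potential and `w` the one in the statement. -/
theorem gegenbauer_formula {p : ℝ} (hp : 0 < p) (k : ℕ) (t : ℝ) {r D c S P : ℝ} (hr : r ≠ 0)
    {w : ℂ} (hS : (ascPochhammer ℝ k).eval (2 * p) = S)
    (hP : (ascPochhammer ℝ k).eval (p + 1 / 2) = P) (hw : (c : ℂ) * (S * k !) = -(w * (2 ^ k * P))) :
    ((c * (powNum p k t (r ^ 2) * D⁻¹) : ℝ) : ℂ) = (-1) ^ (k + 1) * w *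
      (((r ^ k / D : ℝ) : ℂ) * Complex.I ^ k *
        Polynomial.aeval (Complex.I * ((t / r : ℝ) : ℂ)) (gegenbauer k (1 / 2 - p - k))) := by
  have hG := aeval_gegenbauer hp k t hr
  have hS' : (0 : ℝ) < S := hS ▸ ascPochhammer_pos k _ (by positivity)
  have hSk : ((S * k ! : ℝ) : ℂ) ≠ 0 := by exact_mod_cast (by positivity : S * k ! ≠ 0)
  rw [hS, hP] at hG
  refine mul_left_cancel₀ hSk ?_
  push_cast at hG ⊢
  linear_combination ((powNum p k t (r ^ 2) : ℂ) * (D : ℂ)⁻¹) * hw -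
    ((-1) ^ (k + 1) * w * (D : ℂ)⁻¹) * hG +
    (w * (2 ^ k * P) * (powNum p k t (r ^ 2) : ℂ) * (D : ℂ)⁻¹) * neg_one_pow_mul_self k

theorem A_two_eq (n : ℕ) {t : ℝ} (ht : 0 < t) {x : E 2} (hx : x ≠ 0) :
    ∃ a : ℝ, A 2 (n + 1) t x = algebraMap ℝ (Cl 2) a ∧
      (a : ℂ) = (-1) ^ (n + 1 + 1) * (1 / (2 * (Real.pi : ℂ))) * ((n + 1)! : ℂ) *
        ((∏ i ∈ Finset.Icc 1 (n + 1), (2 * i - 1 : ℂ)) /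
          (∏ i ∈ Finset.Icc (n + 1 + 1) (2 * (n + 1)), (i : ℂ))) *
        (((‖x‖ ^ (n + 1) / (t ^ 2 + ‖x‖ ^ 2) ^ (((n + 1 : ℕ) : ℝ) + 1 / 2) : ℝ)) : ℂ) *
        Complex.I ^ (n + 1) * Polynomial.aeval (Complex.I * ((t / ‖x‖ : ℝ) : ℂ))
          (gegenbauer (n + 1) (-((n + 1 : ℕ) : ℝ))) := by
  refine ⟨_, (A_succ_eq le_rfl n ht x).trans (Algebra.algebraMap_eq_smul_one _).symm, ?_⟩
  have hD : 0 < t ^ 2 + ‖x‖ ^ 2 := by positivity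
  have h1 := prod_Icc_odd (n + 1)
  have h2 := prod_Icc_mul_factorial (n + 1) (n + 1)
  rw [← two_mul] at h2
  have hk : ((n + 1)! : ℂ) ≠ 0 := by exact_mod_cast (n + 1).factorial_ne_zero
  have hk2 : ((2 * (n + 1))! : ℂ) ≠ 0 := by exact_mod_cast (2 * (n + 1)).factorial_ne_zero
  have hπ : (Real.pi : ℂ) ≠ 0 := by exact_mod_cast Real.pi_ne_zero
  have hG := gegenbauer_formula (p := 1 / 2) (by norm_num) (n + 1) t
    (D := (t ^ 2 + ‖x‖ ^ 2) ^ (((n + 1 : ℕ) : ℝ) + 1 / 2)) (norm_ne_zero_iff.2 hx)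
    (c := -(1 / (4 * Real.pi * (1 / 2)))) (S := (n + 1)!) (P := (n + 1)!)
    (w := (1 / (2 * (Real.pi : ℂ))) * ((n + 1)! : ℂ) *
        ((∏ i ∈ Finset.Icc 1 (n + 1), (2 * i - 1 : ℂ)) /
          (∏ i ∈ Finset.Icc (n + 1 + 1) (2 * (n + 1)), (i : ℂ))))
    (by norm_num) (by norm_num) (by
      rw [eq_div_of_mul_eq (mul_ne_zero (pow_ne_zero _ two_ne_zero) hk) h1, eq_div_of_mul_eq hk h2]
      push_cast
      field_simp
      norm_num)
  rw [show (1 / 2 : ℝ) - 1 / 2 - (n + 1 : ℕ) = -(n + 1 : ℕ) by ring] at hG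
  rw [powDeriv, halfExp_two, show (2 + 1 : ℕ) = 3 by rfl, sphereArea_three, Real.rpow_neg hD.le,
    add_comm (1 / 2 : ℝ), hG]
  ring

theorem B_two_eq (n : ℕ) {t : ℝ} (ht : 0 < t) {x : E 2} (hx : x ≠ 0) :
    ∃ b : ℝ, B 2 (n + 1) t x = b • vec x ∧
      (b : ℂ) = (-1) ^ (n + 1) * (1 / (2 * (Real.pi : ℂ))) * (n ! : ℂ) *
        ((∏ i ∈ Finset.Icc 2 (n + 1), (2 * i - 1 : ℂ)) /
          (∏ i ∈ Finset.Icc (n + 1 + 2) (2 * (n + 1)), (i : ℂ))) *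
        (((‖x‖ ^ n / (t ^ 2 + ‖x‖ ^ 2) ^ (((n + 1 : ℕ) : ℝ) + 1 / 2) : ℝ)) : ℂ) *
        Complex.I ^ n * Polynomial.aeval (Complex.I * ((t / ‖x‖ : ℝ) : ℂ))
          (gegenbauer n (-((n + 1 : ℕ) : ℝ))) := by
  refine ⟨_, B_succ_eq le_rfl n ht x, ?_⟩
  have hD : 0 < t ^ 2 + ‖x‖ ^ 2 := by positivity
  have h1 := prod_Icc_odd (n + 1)
  have h2 := prod_Icc_mul_factorial (n + 2) n
  rw [show n + 2 + n = 2 * (n + 1) by ring] at h2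
  have hk : ((n + 1)! : ℂ) ≠ 0 := by exact_mod_cast (n + 1).factorial_ne_zero
  have hk2 : ((2 * (n + 1))! : ℂ) ≠ 0 := by exact_mod_cast (2 * (n + 1)).factorial_ne_zero
  have hk3 : ((n + 2)! : ℂ) ≠ 0 := by exact_mod_cast (n + 2).factorial_ne_zero
  have hπ : (Real.pi : ℂ) ≠ 0 := by exact_mod_cast Real.pi_ne_zero
  -- B_{-n-1} is an n-th derivative with exponent p + 1, where p = 1/2, so the parameter is 1/2 -
  -- 3/2 - n = -(n+1), the same as for A_{-n-1}.
  have hG := gegenbauer_formula (p := 3 / 2) (by norm_num) n t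
    (D := (t ^ 2 + ‖x‖ ^ 2) ^ (((n + 1 : ℕ) : ℝ) + 1 / 2)) (norm_ne_zero_iff.2 hx)
    (c := -(2 / (4 * Real.pi))) (S := (n + 2)! / 2) (P := (n + 1)!)
    (w := (1 / (2 * (Real.pi : ℂ))) * (n ! : ℂ) *
        ((∏ i ∈ Finset.Icc 2 (n + 1), (2 * i - 1 : ℂ)) /
          (∏ i ∈ Finset.Icc (n + 1 + 2) (2 * (n + 1)), (i : ℂ))))
    (by norm_num [ascPochhammer_three_eval]) (by norm_num [ascPochhammer_two_eval]) (by
      rw [prod_Icc_two_odd,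
        eq_div_of_mul_eq (mul_ne_zero (pow_ne_zero _ two_ne_zero) hk) h1,
        show n + 1 + 2 = n + 2 + 1 by ring, eq_div_of_mul_eq hk3 h2]
      push_cast
      field_simp
      ring)
  rw [show (1 / 2 : ℝ) - 3 / 2 - n = -(n + 1 : ℕ) by push_cast; ring] at hG
  rw [powDeriv, halfExp_two, show (2 + 1 : ℕ) = 3 by rfl, sphereArea_three, Real.rpow_neg hD.le,
    show (1 / 2 + 1 : ℝ) + n = (n + 1 : ℕ) + 1 / 2 by push_cast; ring,
    show (1 / 2 + 1 : ℝ) = 3 / 2 by norm_num, hG]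
  ring

theorem A_three_eq (n : ℕ) {t : ℝ} (ht : 0 < t) {x : E 3} (hx : x ≠ 0) :
    ∃ a : ℝ, A 3 (n + 1) t x = algebraMap ℝ (Cl 3) a ∧
      (a : ℂ) = (-1) ^ (n + 1 + 1) * (1 / (Real.pi : ℂ) ^ 2) *
        (2 ^ n * ((n + 1)! : ℂ) ^ 2 /
          (∏ i ∈ Finset.Icc (n + 1 + 2) (2 * (n + 1) + 1), (i : ℂ))) *
        (((‖x‖ ^ (n + 1) / (t ^ 2 + ‖x‖ ^ 2) ^ (n + 1 + 1) : ℝ)) : ℂ) *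
        Complex.I ^ (n + 1) * Polynomial.aeval (Complex.I * ((t / ‖x‖ : ℝ) : ℂ))
          (gegenbauer (n + 1) (-((n + 1 : ℕ) : ℝ) - 1 / 2)) := by
  refine ⟨_, (A_succ_eq (by norm_num) n ht x).trans (Algebra.algebraMap_eq_smul_one _).symm, ?_⟩
  have hD : 0 < t ^ 2 + ‖x‖ ^ 2 := by positivity
  have h1 := ascPochhammer_three_halves_eval (n + 1)
  have h2 := prod_Icc_mul_factorial (n + 2) (n + 1)
  rw [show n + 2 + (n + 1) = 2 * (n + 1) + 1 by ring] at h2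
  have hk : ((n + 1)! : ℂ) ≠ 0 := by exact_mod_cast (n + 1).factorial_ne_zero
  have hk2 : ((2 * (n + 1) + 1)! : ℂ) ≠ 0 := by
    exact_mod_cast (2 * (n + 1) + 1).factorial_ne_zero
  have hk3 : ((n + 2)! : ℂ) ≠ 0 := by exact_mod_cast (n + 2).factorial_ne_zero
  have hπ : (Real.pi : ℂ) ≠ 0 := by exact_mod_cast Real.pi_ne_zero
  have h4 : (4 : ℂ) ^ n = 2 ^ n * 2 ^ n := by rw [← mul_pow]; norm_num
  have hG := gegenbauer_formula (p := 1) (by norm_num) (n + 1) t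
    (D := (t ^ 2 + ‖x‖ ^ 2) ^ (n + 1 + 1)) (norm_ne_zero_iff.2 hx)
    (c := -(1 / (2 * Real.pi ^ 2 * 1))) (S := (n + 1 + 1)!)
    (P := (2 * (n + 1) + 1)! / (4 ^ (n + 1) * (n + 1)!))
    (w := (1 / (Real.pi : ℂ) ^ 2) * (2 ^ n * ((n + 1)! : ℂ) ^ 2 /
          (∏ i ∈ Finset.Icc (n + 1 + 2) (2 * (n + 1) + 1), (i : ℂ))))
    (by norm_num [ascPochhammer_two_eval]) (by
      rw [← h1, show (1 + 1 / 2 : ℝ) = 3 / 2 by norm_num]; field_simp) (by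
      rw [show n + 1 + 2 = n + 2 + 1 by ring, eq_div_of_mul_eq hk3 h2]
      push_cast
      rw [pow_succ 4 n, h4]
      field_simp
      ring)
  rw [show (1 / 2 : ℝ) - 1 - (n + 1 : ℕ) = -(n + 1 : ℕ) - 1 / 2 by ring] at hG
  rw [powDeriv, halfExp_three, show (3 + 1 : ℕ) = 4 by rfl, sphereArea_four, Real.rpow_neg hD.le,
    show (1 : ℝ) + (n + 1 : ℕ) = (n + 1 + 1 : ℕ) by push_cast; ring, Real.rpow_natCast, hG]
  ring

theorem B_three_eq (n : ℕ) {t : ℝ} (ht : 0 < t) {x : E 3} (hx : x ≠ 0) :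
    ∃ b : ℝ, B 3 (n + 1) t x = b • vec x ∧
      (b : ℂ) = (-1) ^ (n + 1) * (1 / (Real.pi : ℂ) ^ 2) *
        (2 ^ n * (n ! : ℂ) * ((n + 1)! : ℂ) /
          (∏ i ∈ Finset.Icc (n + 1 + 3) (2 * (n + 1) + 1), (i : ℂ))) *
        (((‖x‖ ^ n / (t ^ 2 + ‖x‖ ^ 2) ^ (n + 1 + 1) : ℝ)) : ℂ) *
        Complex.I ^ n * Polynomial.aeval (Complex.I * ((t / ‖x‖ : ℝ) : ℂ))
          (gegenbauer n (-((n + 1 : ℕ) : ℝ) - 1 / 2)) := by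
  refine ⟨_, B_succ_eq (by norm_num) n ht x, ?_⟩
  have hD : 0 < t ^ 2 + ‖x‖ ^ 2 := by positivity
  have h1 := ascPochhammer_five_halves_eval n
  have h2 := prod_Icc_mul_factorial (n + 3) n
  rw [show n + 3 + n = 2 * n + 3 by ring] at h2
  have hk2 : ((2 * n + 3)! : ℂ) ≠ 0 := by exact_mod_cast (2 * n + 3).factorial_ne_zero
  have hk3 : ((n + 3)! : ℂ) ≠ 0 := by exact_mod_cast (n + 3).factorial_ne_zero
  have hk4 : (n ! : ℂ) ≠ 0 := by exact_mod_cast n.factorial_ne_zero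
  have hk5 : (n + 1 : ℂ) ≠ 0 := by exact_mod_cast n.succ_ne_zero
  have hπ : (Real.pi : ℂ) ≠ 0 := by exact_mod_cast Real.pi_ne_zero
  have h4 : (4 : ℂ) ^ n = 2 ^ n * 2 ^ n := by rw [← mul_pow]; norm_num
  have hG := gegenbauer_formula (p := 2) (by norm_num) n t
    (D := (t ^ 2 + ‖x‖ ^ 2) ^ (n + 1 + 1)) (norm_ne_zero_iff.2 hx)
    (c := -(2 / (2 * Real.pi ^ 2))) (S := (n + 3)! / 6)
    (P := (2 * n + 3)! / (4 ^ n * n ! * (6 * (n + 1))))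
    (w := (1 / (Real.pi : ℂ) ^ 2) * (2 ^ n * (n ! : ℂ) * ((n + 1)! : ℂ) /
          (∏ i ∈ Finset.Icc (n + 1 + 3) (2 * (n + 1) + 1), (i : ℂ))))
    (by norm_num [ascPochhammer_four_eval]) (by
      rw [← h1, show (2 + 1 / 2 : ℝ) = 5 / 2 by norm_num]; field_simp) (by
      rw [show n + 1 + 3 = n + 3 + 1 by ring, show 2 * (n + 1) + 1 = 2 * n + 3 by ring,
        eq_div_of_mul_eq hk3 h2, Nat.factorial_succ n]
      push_cast
      rw [h4]
      field_simp)
  rw [show (1 / 2 : ℝ) - 2 - n = -(n + 1 : ℕ) - 1 / 2 by push_cast; ring] at hG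
  rw [powDeriv, halfExp_three, show (3 + 1 : ℕ) = 4 by rfl, sphereArea_four, Real.rpow_neg hD.le,
    show (1 + 1 : ℝ) = 2 by norm_num, show (2 : ℝ) + n = (n + 1 + 1 : ℕ) by push_cast; ring,
    Real.rpow_natCast, hG]
  ring

end HalfSpace
end

noncomputable section

namespace HalfSpace

/-! ### Expansions in negative powers -/

section Expansion

variable {V W : Type*} [NormedAddCommGroup V] [NormedSpace ℝ V] [NormedAddCommGroup W]
  [NormedSpace ℝ W]

/-- `G(ε) = ∑_{1 ≤ j ≤ N} c_j ε^{-j} + L + o(1)` as `ε → 0+`. -/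
def HasExpansion (N : ℕ) (G : ℝ → V) (L : V) : Prop :=
  ∃ c : ℕ → V,
    Tendsto (fun ε : ℝ => G ε - ∑ j ∈ Finset.Icc 1 N, (ε ^ j)⁻¹ • c j) (𝓝[>] 0) (𝓝 L)

theorem HasExpansion.hasFinitePart {N : ℕ} {G : ℝ → V} {L : V} (h : HasExpansion N G L) :
    HasFinitePart G L := by
  obtain ⟨c, hc⟩ := h
  exact ⟨N, c, 0, by simpa using hc⟩

theorem hasExpansion_zero_iff {G : ℝ → V} {L : V} :
    HasExpansion 0 G L ↔ Tendsto G (𝓝[>] 0) (𝓝 L) := by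
  simp [HasExpansion]

theorem HasExpansion.mono {N M : ℕ} (hNM : N ≤ M) {G : ℝ → V} {L : V} (h : HasExpansion N G L) :
    HasExpansion M G L := by
  obtain ⟨c, hc⟩ := h
  refine ⟨fun j => if j ≤ N then c j else 0, hc.congr fun ε => ?_⟩
  congr 1
  refine Finset.sum_subset_zero_on_sdiff (Finset.Icc_subset_Icc_right hNM) (fun j hj => ?_)
    fun j hj => ?_
  · simp only [Finset.mem_sdiff, Finset.mem_Icc] at hj
    simp only [if_neg (show ¬ j ≤ N by omega), smul_zero]
  · simp only [if_pos (Finset.mem_Icc.1 hj).2]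

theorem HasExpansion.add {N : ℕ} {G G' : ℝ → V} {L L' : V} (h : HasExpansion N G L)
    (h' : HasExpansion N G' L') : HasExpansion N (fun ε => G ε + G' ε) (L + L') := by
  obtain ⟨c, hc⟩ := h
  obtain ⟨c', hc'⟩ := h'
  refine ⟨c + c', (hc.add hc').congr fun ε => ?_⟩
  simp only [Pi.add_apply, smul_add, Finset.sum_add_distrib]
  abel

theorem HasExpansion.map {N : ℕ} {G : ℝ → V} {L : V} (h : HasExpansion N G L) (A : V →L[ℝ] W) :
    HasExpansion N (fun ε => A (G ε)) (A L) := by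
  obtain ⟨c, hc⟩ := h
  refine ⟨fun j => A (c j), ((A.continuous.tendsto _).comp hc).congr fun ε => ?_⟩
  simp

theorem HasExpansion.congr {N : ℕ} {G G' : ℝ → V} {L : V} (h : HasExpansion N G L)
    (hG : ∀ ε, 0 < ε → G ε = G' ε) : HasExpansion N G' L := by
  obtain ⟨c, hc⟩ := h
  refine ⟨c, hc.congr' ?_⟩
  filter_upwards [self_mem_nhdsWithin] with ε hε
  rw [hG ε hε]

theorem HasExpansion.sum {ι : Type*} (s : Finset ι) {N : ℕ} {G : ι → ℝ → V} {L : ι → V}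
    (h : ∀ i, HasExpansion N (G i) (L i)) :
    HasExpansion N (fun ε => ∑ i ∈ s, G i ε) (∑ i ∈ s, L i) := by
  classical
  induction s using Finset.induction_on with
  | empty => exact ⟨0, by simp⟩
  | insert i s hi ih =>
    simp only [Finset.sum_insert hi]
    exact (h i).add ih

/-- The Taylor expansion of a function whose parity kills the term of order `n`. -/
theorem hasExpansion_of_parity {n : ℕ} {g : ℝ → V} (hg : ContDiff ℝ n g)
    (hpar : ∀ s, g (-s) = (-1 : ℝ) ^ (n + 1) • g s) :
    HasExpansion n (fun s => (s ^ n)⁻¹ • g s) 0 := by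
  -- Differentiating the parity relation n times at 0 shows that this derivative equals its own
  -- negative.
  have h0 : iteratedDeriv n g 0 = 0 := by
    have h1 := iteratedDeriv_comp_neg n g 0
    rw [neg_zero, funext hpar, iteratedDeriv_fun_const_smul_field, pow_succ] at h1
    have h2 : (-1 : ℝ) ^ n * (-1) ^ n = 1 := by rw [← mul_pow]; simp
    have h3 := congrArg (fun v => (-1 : ℝ) ^ n • v) h1
    simp only [smul_smul, ← mul_assoc, h2, one_mul, one_smul, neg_smul] at h3
    have h4 : (2 : ℝ) • iteratedDeriv n g 0 = 0 := by
      rw [two_smul]; nth_rewrite 1 [← h3]; exact neg_add_cancel _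
    exact (smul_eq_zero.1 h4).resolve_left two_ne_zero
  -- Division by sⁿ turns the Taylor term of order n - j into the power s⁻ʲ.
  refine ⟨fun j => ((n - j)! : ℝ)⁻¹ • iteratedDeriv (n - j) g 0, ?_⟩
  have h1 := taylor_tendsto (x₀ := 0) convex_univ (mem_univ (0 : ℝ)) hg.contDiffOn (n := n)
  rw [nhdsWithin_univ] at h1
  refine (h1.mono_left nhdsWithin_le_nhds).congr' ?_
  filter_upwards [self_mem_nhdsWithin] with s hs
  have hs : s ≠ 0 := (show 0 < s from hs).ne'
  rw [sub_zero, taylor_within_apply, smul_sub, Finset.sum_range_succ, iteratedDerivWithin_univ, h0,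
    smul_zero, add_zero, Finset.smul_sum]
  congr 1
  refine Finset.sum_nbij' (fun k => n - k) (fun j => n - j) ?_ ?_ ?_ ?_ ?_
  · intro k hk; simp at hk ⊢; omega
  · intro j hj; simp at hj ⊢; omega
  · intro k hk; simp at hk ⊢; omega
  · intro j hj; simp at hj ⊢; omega
  · intro k hk
    have hk : k < n := Finset.mem_range.1 hk
    obtain ⟨l, rfl⟩ : ∃ l, n = k + l := ⟨n - k, by omega⟩
    rw [show k + l - k = l by omega, show k + l - l = k by omega, iteratedDerivWithin_univ,
      sub_zero, smul_smul, smul_smul]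
    congr 1
    rw [pow_add]
    field_simp

end Expansion

/-! ### Smoothness of scaled averages -/

section Averages

variable {m : ℕ} {V : Type*} [NormedAddCommGroup V] [NormedSpace ℝ V]

theorem integrable_comp_smul_smul {R : ℝ} {f : E m → ℝ} (hf : Continuous f) {Q : E m → V}
    (hQ : Integrable Q) (hR : ∀ y, R < ‖y‖ → Q y = 0) (s : ℝ) :
    Integrable fun y => f (s • y) • Q y := by
  obtain ⟨C, hC⟩ := (isCompact_closedBall (0 : E m) R).exists_bound_of_continuousOn
    (f := fun y => f (s • y)) (by fun_prop)
  refine (hQ.norm.const_mul C).mono' (by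
    have : AEStronglyMeasurable (fun y : E m => f (s • y)) volume :=
      (hf.comp (continuous_const_smul s)).aestronglyMeasurable
    exact this.smul hQ.aestronglyMeasurable) (ae_of_all _ fun y => ?_)
  rcases le_or_gt ‖y‖ R with h | h
  · rw [norm_smul]
    exact mul_le_mul_of_nonneg_right (hC y (by simpa using h)) (norm_nonneg _)
  · simp [hR y h]

/-- The derivative is a sum of integrals of the same shape, with `f` replaced by ∂_j f and `Q` by
y_j Q. That stability is what makes the induction on smoothness in `contDiff_integral_comp_smul`
work. -/
theorem hasDerivAt_integral_comp_smul {R : ℝ} {f : E m → ℝ} (hf : ContDiff ℝ 1 f) {Q : E m → V}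
    (hQ : Integrable Q) (hR : ∀ y, R < ‖y‖ → Q y = 0) (s : ℝ) :
    HasDerivAt (fun s => ∫ y, f (s • y) • Q y)
      (∑ j, ∫ y, fderiv ℝ f (s • y) (EuclideanSpace.single j 1) • (y j • Q y)) s := by
  have hf' : Continuous (fderiv ℝ f) := hf.continuous_fderiv one_ne_zero
  have hQj : ∀ j, Integrable fun y => y j • Q y := fun j => by
    simpa using integrable_comp_smul_smul (f := fun y => y j) (by fun_prop) hQ hR 1
  have hQj0 : ∀ j y, R < ‖y‖ → y j • Q y = 0 := fun j y hy => by rw [hR y hy, smul_zero]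
  have hsum : ∀ (x : ℝ) (y : E m), fderiv ℝ f (x • y) y • Q y =
      ∑ j, fderiv ℝ f (x • y) (EuclideanSpace.single j 1) • (y j • Q y) := by
    intro x y
    have : y = ∑ j, (y j : ℝ) • (EuclideanSpace.single j (1 : ℝ) : E m) := by
      simpa using ((EuclideanSpace.basisFun (Fin m) ℝ).sum_repr y).symm
    conv_lhs => enter [1, 2]; rw [this]
    rw [map_sum, Finset.sum_smul]
    refine Finset.sum_congr rfl fun j _ => ?_
    rw [map_smul, smul_eq_mul, smul_smul, mul_comm]
  rw [← integral_finsetSum _ fun j _ => integrable_comp_smul_smul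
    (f := fun z => fderiv ℝ f z (EuclideanSpace.single j 1)) (by fun_prop) (hQj j) (hQj0 j) s]
  simp only [← hsum]
  -- For parameters within distance 1 of `s`, the points where `Q` can be nonzero are scaled into
  -- this ball.
  obtain ⟨C, hC⟩ := (isCompact_closedBall (0 : E m) ((|s| + 1) * R)).exists_bound_of_continuousOn
    hf'.continuousOn
  refine (hasDerivAt_integral_of_dominated_loc_of_deriv_le
    (F' := fun x y => fderiv ℝ f (x • y) y • Q y) (bound := fun y => C * ‖R‖ * ‖Q y‖)
    (Metric.ball_mem_nhds s one_pos) (.of_forall fun x =>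
      (integrable_comp_smul_smul hf.continuous hQ hR x).aestronglyMeasurable)
    (integrable_comp_smul_smul hf.continuous hQ hR s) ?_ (ae_of_all _ fun y x hx => ?_)
    (hQ.norm.const_mul _) (ae_of_all _ fun y x _ => ?_)).2
  · have : AEStronglyMeasurable (fun y : E m => fderiv ℝ f (s • y) y) volume := by
      have : Continuous (fun y : E m => fderiv ℝ f (s • y) y) := by fun_prop
      exact this.aestronglyMeasurable
    exact this.smul hQ.aestronglyMeasurable
  · rcases le_or_gt ‖y‖ R with h | h
    · rw [norm_smul]
      refine mul_le_mul_of_nonneg_right ?_ (norm_nonneg _)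
      refine (ContinuousLinearMap.le_opNorm _ _).trans ?_
      have hx' : |x| ≤ |s| + 1 := by
        rw [Metric.mem_ball, Real.dist_eq] at hx
        have := abs_sub_abs_le_abs_sub x s
        linarith
      have h1 := hC (x • y) (by
        rw [mem_closedBall_zero_iff, norm_smul, Real.norm_eq_abs]
        exact mul_le_mul hx' h (norm_nonneg _) (by positivity))
      exact mul_le_mul h1 (h.trans (le_abs_self R)) (norm_nonneg _) ((norm_nonneg _).trans h1)
    · simp [hR y h]
  · have h1 : HasDerivAt (fun x : ℝ => x • y) y x := by
      simpa using (hasDerivAt_id x).smul_const y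
    exact (((hf.differentiable one_ne_zero (x • y)).hasFDerivAt.comp_hasDerivAt x h1)).smul_const _

theorem contDiff_integral_comp_smul {R : ℝ} (n : ℕ) : ∀ {f : E m → ℝ}, ContDiff ℝ (⊤ : ℕ∞) f →
    ∀ {Q : E m → V}, Integrable Q → (∀ y, R < ‖y‖ → Q y = 0) →
    ContDiff ℝ n fun s : ℝ => ∫ y, f (s • y) • Q y := by
  induction n with
  | zero =>
    intro f hf Q hQ hR
    refine contDiff_zero.2 (continuous_iff_continuousAt.2 fun s => ?_)
    exact (hasDerivAt_integral_comp_smul (hf.of_le (by norm_cast)) hQ hR s).continuousAt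
  | succ n ih =>
    intro f hf Q hQ hR
    have h1 := fun s => hasDerivAt_integral_comp_smul (hf.of_le (by norm_cast)) hQ hR s
    push_cast
    rw [contDiff_succ_iff_deriv]
    refine ⟨fun s => (h1 s).differentiableAt, by simp, ?_⟩
    rw [funext fun s => (h1 s).deriv]
    refine ContDiff.sum fun j _ => ?_
    refine ih (f := fun z => fderiv ℝ f z (EuclideanSpace.single j 1)) ?_ ?_ ?_
    · exact (hf.fderiv_right (m := (⊤ : ℕ∞)) (by norm_cast)).clm_apply contDiff_const
    · simpa using integrable_comp_smul_smul (f := fun y => y j) (by fun_prop) hQ hR 1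
    · intro y hy; rw [hR y hy, smul_zero]

theorem integral_comp_neg_smul {f : E m → ℝ} {Q : E m → V} {c : ℝ} (hQ : ∀ y, Q (-y) = c • Q y)
    (s : ℝ) : ∫ y, f (-s • y) • Q y = c • ∫ y, f (s • y) • Q y := by
  rw [← integral_neg_eq_self, ← integral_smul]
  refine integral_congr_ae (ae_of_all _ fun y => ?_)
  simp only [hQ, smul_neg, neg_smul, neg_neg]
  rw [smul_comm]

end Averages

end HalfSpace
end

noncomputable section

namespace HalfSpace

/-! ### Differentiation of finite parts -/

section Kernels

variable {m : ℕ} {V : Type*} [NormedAddCommGroup V] [NormedSpace ℝ V]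

theorem continuous_smul_kernel {u : E m → ℝ} {K : E m → V} (hu : Continuous u)
    (hK : ContinuousOn K {0}ᶜ) (h0 : ∀ᶠ x in 𝓝 0, u x = 0) : Continuous fun x => u x • K x := by
  refine continuous_iff_continuousAt.2 fun x => ?_
  rcases eq_or_ne x 0 with rfl | hx
  · refine (continuousAt_const (y := (0 : V))).congr ?_
    filter_upwards [h0] with x hx
    rw [hx, zero_smul]
  · exact hu.continuousAt.smul (hK.continuousAt (isOpen_compl_singleton.mem_nhds hx))

theorem integrable_smul_kernel {u : E m → ℝ} {K : E m → V} (hu : Continuous u)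
    (hc : HasCompactSupport u) (hK : ContinuousOn K {0}ᶜ) (h0 : ∀ᶠ x in 𝓝 0, u x = 0) :
    Integrable fun x => u x • K x :=
  (continuous_smul_kernel hu hK h0).integrable_of_hasCompactSupport hc.smul_right

theorem integrable_indicator_smul_kernel {u : E m → ℝ} {K : E m → V} (hu : Continuous u)
    (hc : HasCompactSupport u) (hK : ContinuousOn K {0}ᶜ) {s : ℝ} (hs : 0 < s) :
    Integrable ({x : E m | s < ‖x‖}.indicator fun x => u x • K x) := by
  have hm : MeasurableSet {x : E m | s < ‖x‖} := measurableSet_lt measurable_const measurable_norm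
  rw [integrable_indicator_iff hm]
  have hcl : IsClosed {x : E m | s ≤ ‖x‖} := isClosed_le continuous_const continuous_norm
  have h1 : IsCompact (tsupport u ∩ {x : E m | s ≤ ‖x‖}) := hc.inter_right hcl
  have h2 : IntegrableOn (fun x => u x • K x) (tsupport u ∩ {x : E m | s ≤ ‖x‖}) := by
    refine ContinuousOn.integrableOn_compact h1 (hu.continuousOn.smul (hK.mono ?_))
    rintro x ⟨-, hx⟩ rfl
    simp at hx; linarith
  have h3 : IntegrableOn (fun x => u x • K x) {x : E m | s ≤ ‖x‖} := by
    refine h2.of_forall_sdiff_eq_zero hcl.measurableSet fun x hx => ?_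
    have : x ∉ tsupport u := fun h => hx.2 ⟨h, hx.1⟩
    rw [image_eq_zero_of_notMem_tsupport this, zero_smul]
  exact h3.mono_set fun x (hx : s < ‖x‖) => hx.le

/-- Integration by parts against a kernel with a singularity at the origin. -/
theorem integral_smul_kernel_eq_neg {u : E m → ℝ} {K K' : E m → V} {v : E m}
    (hu : ContDiff ℝ 1 u) (hc : HasCompactSupport u) (hK : ContinuousOn K {0}ᶜ)
    (hK' : ContinuousOn K' {0}ᶜ) (hd : ∀ x, x ≠ 0 → HasLineDerivAt ℝ K (K' x) x v)
    (h0 : ∀ᶠ x in 𝓝 0, u x = 0) :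
    ∫ x, u x • K' x = -∫ x, fderiv ℝ u x v • K x := by
  have hu' : Continuous fun x => fderiv ℝ u x v :=
    (hu.continuous_fderiv one_ne_zero).clm_apply continuous_const
  have hc' : HasCompactSupport fun x => fderiv ℝ u x v := hc.fderiv_apply ℝ v
  have h0' : ∀ᶠ x in 𝓝 0, fderiv ℝ u x v = 0 := by
    filter_upwards [h0.eventually_nhds] with x hx
    have : u =ᶠ[𝓝 x] fun _ => 0 := hx
    rw [this.fderiv_eq]; simp
  refine integral_bilinear_hasLineDerivAt_right_eq_neg_left_of_integrable
    (B := ContinuousLinearMap.lsmul ℝ ℝ) (integrable_smul_kernel hu' hc' hK h0')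
    (integrable_smul_kernel hu.continuous hc hK' h0)
    (integrable_smul_kernel hu.continuous hc hK h0)
    (fun x _ => (hu.differentiable one_ne_zero x).hasFDerivAt.hasLineDerivAt v) fun x hx => hd x ?_
  rintro rfl
  exact notMem_tsupport_iff_eventuallyEq.2 h0 hx

/-- `K` has the homogeneity degree `1 - m - n` and the parity of `n`. -/
def IsHomogeneousKernel (n : ℕ) (K : E m → V) : Prop :=
  ∀ s : ℝ, s ≠ 0 → ∀ x : E m, x ≠ 0 → K (s • x) = (|s| / (|s| ^ m * s ^ n)) • K x

theorem IsHomogeneousKernel.neg {n : ℕ} {K : E m → V} (h : IsHomogeneousKernel n K) {x : E m}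
    (hx : x ≠ 0) : K (-x) = (-1 : ℝ) ^ n • K x := by
  have := h (-1) (by norm_num) x hx
  rw [neg_one_smul] at this
  rw [this]
  rcases neg_one_pow_eq_or ℝ n with h | h <;> simp [h]

/-- Differentiating K(sx + tv) = (|s|/(|s|^m sⁿ)) K(x + (t/s)v) at t = 0 gives one more factor s⁻¹;
for negative s it also flips the parity. -/
theorem IsHomogeneousKernel.lineDeriv {n : ℕ} {K K' : E m → V} {v : E m}
    (h : IsHomogeneousKernel n K) (hd : ∀ x, x ≠ 0 → HasLineDerivAt ℝ K (K' x) x v) :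
    IsHomogeneousKernel (n + 1) K' := by
  intro s hs x hx
  have hsx : s • x ≠ 0 := smul_ne_zero hs hx
  have h1 : HasDerivAt (fun t : ℝ => K (x + (s⁻¹ * t) • v)) (s⁻¹ • K' x) 0 := by
    have h2 : HasDerivAt (fun t : ℝ => s⁻¹ * t) s⁻¹ 0 := by
      simpa using (hasDerivAt_id (0 : ℝ)).const_mul s⁻¹
    have h3 : HasDerivAt (fun t : ℝ => K (x + t • v)) (K' x) (s⁻¹ * 0) := by
      rw [mul_zero]; exact hd x hx
    exact h3.scomp (0 : ℝ) h2
  have h2 := h1.const_smul (|s| / (|s| ^ m * s ^ n))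
  have h3 : HasDerivAt (fun t : ℝ => K (s • x + t • v)) (K' (s • x)) 0 := hd _ hsx
  have h4 : (fun t : ℝ => K (s • x + t • v)) =ᶠ[𝓝 0]
      fun t : ℝ => (|s| / (|s| ^ m * s ^ n)) • K (x + (s⁻¹ * t) • v) := by
    have : ContinuousAt (fun t : ℝ => x + (s⁻¹ * t) • v) 0 := by fun_prop
    have h5 : ∀ᶠ t : ℝ in 𝓝 0, x + (s⁻¹ * t) • v ≠ 0 := this.eventually_ne (by simpa using hx)
    filter_upwards [h5] with t ht
    rw [← h s hs _ ht, smul_add, smul_smul, mul_inv_cancel_left₀ hs]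
  rw [(h2.congr_of_eventuallyEq h4).unique h3 |>.symm, smul_smul]
  congr 1
  rw [pow_succ]; field_simp

/-! ### Smooth cut-offs and the boundary term of integration by parts. -/

/-- A bump function equal to `1` on the ball of radius `2` and to `0` off the ball of radius `3`. -/
def bump (m : ℕ) : ContDiffBump (0 : E m) := ⟨2, 3, two_pos, by norm_num⟩

/-- The inner radius 2 leaves a margin around the closed unit ball, so the derivative lives strictly
away from the set removed in `cutKernel`. -/
theorem fderiv_bump_eq_zero {y : E m} (hy : ‖y‖ ≤ 1) : fderiv ℝ (bump m) y = 0 := by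
  have : (bump m : E m → ℝ) =ᶠ[𝓝 y] fun _ => 1 := by
    have h2 : Metric.ball (0 : E m) 2 ∈ 𝓝 y :=
      Metric.isOpen_ball.mem_nhds (by rw [mem_ball_zero_iff]; linarith)
    filter_upwards [h2] with z hz
    exact (bump m).one_of_mem_closedBall (Metric.ball_subset_closedBall hz)
  rw [this.fderiv_eq]; simp

theorem fderiv_bump_neg (y v : E m) : fderiv ℝ (bump m) (-y) v = -fderiv ℝ (bump m) y v := by
  have h : (fun y : E m => bump m (-y)) = bump m := funext fun y => (bump m).neg y
  have h1 : fderiv ℝ (fun y : E m => bump m (-y)) y = -fderiv ℝ (bump m) (-y) :=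
    ((((bump m).contDiff (n := 1)).differentiable one_ne_zero (-y)).hasFDerivAt.comp y
      (hasFDerivAt_id y).neg).fderiv.trans (by ext; simp)
  rw [h] at h1
  simp [h1]

theorem bump_eq_zero {y : E m} (hy : 3 < ‖y‖) : bump m y = 0 :=
  (bump m).zero_of_le_dist (by rw [dist_zero_right]; exact hy.le)

theorem fderiv_bump_eq_zero' {y : E m} (hy : 3 < ‖y‖) : fderiv ℝ (bump m) y = 0 := by
  have : (bump m : E m → ℝ) =ᶠ[𝓝 y] fun _ => 0 := by
    filter_upwards [(isOpen_lt continuous_const continuous_norm).mem_nhds hy] with z hz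
    exact bump_eq_zero hz
  rw [this.fderiv_eq]; simp

variable {n : ℕ} {K K' : E m → V} {v : E m} {f : E m → ℝ}

/-- The part of a cut-off kernel outside the unit ball. -/
def cutKernel (K : E m → V) : E m → V :=
  {x : E m | 1 < ‖x‖}.indicator fun x => bump m x • K x

/-- A kernel multiplied by the derivative of the cut-off function. -/
def shellKernel (v : E m) (K : E m → V) (x : E m) : V := fderiv ℝ (bump m) x v • K x

theorem integrable_cutKernel (hK : ContinuousOn K {0}ᶜ) : Integrable (cutKernel K) :=
  integrable_indicator_smul_kernel (bump m).continuous (bump m).hasCompactSupport hK one_pos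

theorem cutKernel_eq_zero {y : E m} (hy : 3 < ‖y‖) : cutKernel K y = 0 := by
  simp [cutKernel, indicator, bump_eq_zero hy]

theorem continuous_fderiv_bump (v : E m) : Continuous fun x => fderiv ℝ (bump m) x v :=
  (((bump m).contDiff (n := 1)).continuous_fderiv one_ne_zero).clm_apply continuous_const

theorem integrable_shellKernel (v : E m) (hK : ContinuousOn K {0}ᶜ) :
    Integrable (shellKernel v K) :=
  integrable_smul_kernel (continuous_fderiv_bump v)
    ((bump m).hasCompactSupport.fderiv_apply ℝ v) hK (by
      filter_upwards [Metric.ball_mem_nhds (0 : E m) one_pos] with y hy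
      rw [fderiv_bump_eq_zero (by simpa using (mem_ball_zero_iff.1 hy).le)]; simp)

theorem shellKernel_eq_zero {y : E m} (hy : 3 < ‖y‖) : shellKernel v K y = 0 := by
  simp [shellKernel, fderiv_bump_eq_zero' hy]

theorem cutKernel_neg (h : IsHomogeneousKernel n K) (y : E m) :
    cutKernel K (-y) = (-1 : ℝ) ^ n • cutKernel K y := by
  by_cases hy : 1 < ‖y‖
  · have hy0 : y ≠ 0 := norm_pos_iff.1 (one_pos.trans hy)
    simp only [cutKernel, indicator, mem_ofPred_eq, norm_neg, hy, if_true, (bump m).neg, h.neg hy0]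
    rw [smul_comm]
  · simp [cutKernel, indicator, hy]

theorem shellKernel_neg (h : IsHomogeneousKernel n K) (v y : E m) :
    shellKernel v K (-y) = (-1 : ℝ) ^ (n + 1) • shellKernel v K y := by
  rcases eq_or_ne y 0 with rfl | hy
  · simp [shellKernel, fderiv_bump_eq_zero]
  · rw [shellKernel, shellKernel, h.neg hy, fderiv_bump_neg, smul_smul, smul_smul, pow_succ]
    congr 1; ring

/-- The boundary term of the integration by parts on `|x| > s`. -/
theorem setIntegral_smul_kernel_add (hf : ContDiff ℝ (⊤ : ℕ∞) f) (hc : HasCompactSupport f)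
    (hK : ContinuousOn K {0}ᶜ) (hK' : ContinuousOn K' {0}ᶜ)
    (hd : ∀ x, x ≠ 0 → HasLineDerivAt ℝ K (K' x) x v) (h : IsHomogeneousKernel n K)
    {s : ℝ} (hs : 0 < s) :
    ∫ x in {x : E m | s < ‖x‖}, f x • K' x = -(∫ x in {x : E m | s < ‖x‖}, fderiv ℝ f x v • K x) +
      (s ^ n)⁻¹ • (s • (∫ y, fderiv ℝ f (s • y) v • cutKernel K y) +
        ∫ y, f (s • y) • (cutKernel K' y + shellKernel v K y)) := by
  have hs0 := hs.ne'
  have hf1 : ContDiff ℝ 1 f := hf.of_le (by norm_cast)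
  have hf' : Continuous fun x => fderiv ℝ f x v :=
    (hf1.continuous_fderiv one_ne_zero).clm_apply continuous_const
  have hc' : HasCompactSupport fun x => fderiv ℝ f x v := hc.fderiv_apply ℝ v
  have hb : Continuous fun x : E m => bump m (s⁻¹ • x) :=
    (bump m).continuous.comp (continuous_const_smul _)
  have hb' : Continuous fun x : E m => fderiv ℝ (bump m) (s⁻¹ • x) v :=
    (continuous_fderiv_bump v).comp (continuous_const_smul _)
  set S : Set (E m) := {x : E m | s < ‖x‖} with hS
  have hSm : MeasurableSet S := measurableSet_lt measurable_const measurable_norm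
  -- This cut-off test function vanishes near the origin, so integration by parts on the whole space
  -- replaces a surface integral over |x| = s. The discrepancy with `f` is `P1`, `P2` and `P3`.
  let u : E m → ℝ := fun x => (1 - bump m (s⁻¹ • x)) * f x
  have hu : ContDiff ℝ 1 u := (contDiff_const.sub
    (((bump m).contDiff (n := 1)).comp (contDiff_const_smul s⁻¹))).mul hf1
  have huc : HasCompactSupport u := hc.mul_left
  have hsmall : ∀ x : E m, ‖x‖ ≤ s → ‖s⁻¹ • x‖ ≤ 1 := fun x hx => by
    rw [norm_smul, norm_inv, Real.norm_eq_abs, abs_of_pos hs, inv_mul_le_iff₀ hs, mul_one]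
    exact hx
  have hb1 : ∀ x : E m, ‖x‖ ≤ s → bump m (s⁻¹ • x) = 1 := fun x hx =>
    (bump m).one_of_mem_closedBall (by
      rw [mem_closedBall_zero_iff]; exact (hsmall x hx).trans one_le_two)
  have hu0 : ∀ x, ‖x‖ ≤ s → u x = 0 := fun x hx => by simp [u, hb1 x hx]
  have hu0' : ∀ᶠ x in 𝓝 0, u x = 0 := by
    filter_upwards [Metric.ball_mem_nhds (0 : E m) hs] with x hx
    exact hu0 x (mem_ball_zero_iff.1 hx).le
  have hu' : ∀ x, fderiv ℝ u x v = (1 - bump m (s⁻¹ • x)) * fderiv ℝ f x v -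
      s⁻¹ * fderiv ℝ (bump m) (s⁻¹ • x) v * f x := by
    intro x
    have h1 : HasFDerivAt (fun x : E m => bump m (s⁻¹ • x))
        ((fderiv ℝ (bump m) (s⁻¹ • x)).comp (s⁻¹ • ContinuousLinearMap.id ℝ (E m))) x :=
      (((bump m).contDiff (n := 1)).differentiable one_ne_zero _).hasFDerivAt.comp x
        ((hasFDerivAt_id x).const_smul s⁻¹)
    have h2 := (h1.const_sub 1).mul (hf1.differentiable one_ne_zero x).hasFDerivAt
    rw [HasFDerivAt.fderiv (f := u) h2]
    simp
    ring
  have hIBP := integral_smul_kernel_eq_neg hu huc hK hK' hd hu0'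
  have hu'c : Continuous fun x => fderiv ℝ u x v :=
    (hu.continuous_fderiv one_ne_zero).clm_apply continuous_const
  have hu'0 : ∀ᶠ x in 𝓝 0, fderiv ℝ u x v = 0 := by
    filter_upwards [hu0'.eventually_nhds] with x hx
    have : u =ᶠ[𝓝 x] fun _ => 0 := hx
    rw [this.fderiv_eq]; simp
  have i1 := integrable_indicator_smul_kernel hf.continuous hc hK' hs
  have i2 := integrable_indicator_smul_kernel hf' hc' hK hs
  have i3 := integrable_smul_kernel hu.continuous huc hK' hu0'
  have i4 := integrable_smul_kernel hu'c (huc.fderiv_apply ℝ v) hK hu'0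
  let P1 : E m → V := S.indicator fun x => (bump m (s⁻¹ • x) * f x) • K' x
  let P2 : E m → V := S.indicator fun x => (bump m (s⁻¹ • x) * fderiv ℝ f x v) • K x
  let P3 : E m → V := fun x => (fderiv ℝ (bump m) (s⁻¹ • x) v * f x) • K x
  have i5 : Integrable P1 := integrable_indicator_smul_kernel (hb.mul hf.continuous)
    hc.mul_left hK' hs
  have i6 : Integrable P2 := integrable_indicator_smul_kernel (hb.mul hf') hc'.mul_left hK hs
  have i7 : Integrable P3 := integrable_smul_kernel (hb'.mul hf.continuous) hc.mul_left hK (by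
    filter_upwards [Metric.ball_mem_nhds (0 : E m) hs] with x hx
    rw [fderiv_bump_eq_zero (hsmall x (mem_ball_zero_iff.1 hx).le)]; simp)
  -- The bracket with `u` integrates to zero by `hIBP`; the other three terms are rescaled by x = sy
  -- below.
  have hpt : ∀ x, S.indicator (fun x => f x • K' x) x + S.indicator (fun x => fderiv ℝ f x v • K x) x
      = (u x • K' x + fderiv ℝ u x v • K x) + (P1 x + P2 x + s⁻¹ • P3 x) := by
    intro x
    by_cases hx : x ∈ S
    · simp only [P1, P2, P3, indicator_of_mem hx, hu', u]
      module
    · have hx' : ‖x‖ ≤ s := not_lt.1 hx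
      simp only [P1, P2, P3, indicator_of_notMem hx, hu', hu0 x hx', hb1 x hx',
        fderiv_bump_eq_zero (hsmall x hx')]
      simp
  have hint : (∫ x in S, f x • K' x) + (∫ x in S, fderiv ℝ f x v • K x) =
      (∫ x, P1 x) + (∫ x, P2 x) + s⁻¹ • ∫ x, P3 x := by
    rw [← integral_indicator hSm, ← integral_indicator hSm, ← integral_add i1 i2,
      integral_congr_ae (ae_of_all _ hpt),
      integral_add (f := fun x => u x • K' x + fderiv ℝ u x v • K x)
        (g := fun x => P1 x + P2 x + s⁻¹ • P3 x) (i3.add i4) ((i5.add i6).add (i7.smul s⁻¹)),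
      integral_add i3 i4, hIBP, neg_add_cancel, zero_add, integral_add (f := fun x => P1 x + P2 x)
        (g := fun x => s⁻¹ • P3 x) (i5.add i6) (i7.smul s⁻¹),
      integral_add i5 i6, integral_smul]
  -- The Jacobian s^m cancels against homogeneity: the terms with `K'` and with the derivative of
  -- the bump scale as s⁻ⁿ, the one with ∂f as s · s⁻ⁿ.
  have hscale : ∀ F : E m → V, ∫ x, F x = s ^ m • ∫ y, F (s • y) := by
    intro F
    rw [Measure.integral_comp_smul, finrank_euclideanSpace_fin, smul_smul, abs_of_pos (by positivity),
      mul_inv_cancel₀ (by positivity), one_smul]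
  have hmemS : ∀ y : E m, s • y ∈ S ↔ 1 < ‖y‖ := fun y => by
    rw [hS, mem_ofPred_eq, norm_smul, Real.norm_eq_abs, abs_of_pos hs, lt_mul_iff_one_lt_right hs]
  have e1 : ∫ x, P1 x = (s ^ n)⁻¹ • ∫ y, f (s • y) • cutKernel K' y := by
    rw [hscale, ← integral_smul, ← integral_smul]
    refine integral_congr_ae (ae_of_all _ fun y => ?_)
    by_cases hy : 1 < ‖y‖
    · have hy0 : y ≠ 0 := norm_pos_iff.1 (one_pos.trans hy)
      simp only [P1, cutKernel, indicator_of_mem ((hmemS y).2 hy),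
        indicator_of_mem (show y ∈ {x : E m | 1 < ‖x‖} from hy), inv_smul_smul₀ hs0,
        h.lineDeriv hd s hs0 y hy0, abs_of_pos hs, smul_smul]
      congr 1
      rw [pow_succ]; field_simp
    · simp only [P1, cutKernel, indicator_of_notMem ((hmemS y).not.2 hy),
        indicator_of_notMem (show y ∉ {x : E m | 1 < ‖x‖} from hy), smul_zero]
  have e2 : ∫ x, P2 x = (s ^ n)⁻¹ • s • ∫ y, fderiv ℝ f (s • y) v • cutKernel K y := by
    rw [hscale, ← integral_smul, ← integral_smul, ← integral_smul]
    refine integral_congr_ae (ae_of_all _ fun y => ?_)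
    by_cases hy : 1 < ‖y‖
    · have hy0 : y ≠ 0 := norm_pos_iff.1 (one_pos.trans hy)
      simp only [P2, cutKernel, indicator_of_mem ((hmemS y).2 hy),
        indicator_of_mem (show y ∈ {x : E m | 1 < ‖x‖} from hy), inv_smul_smul₀ hs0,
        h s hs0 y hy0, abs_of_pos hs, smul_smul]
      congr 1
      field_simp
    · simp only [P2, cutKernel, indicator_of_notMem ((hmemS y).not.2 hy),
        indicator_of_notMem (show y ∉ {x : E m | 1 < ‖x‖} from hy), smul_zero]
  have e3 : s⁻¹ • ∫ x, P3 x = (s ^ n)⁻¹ • ∫ y, f (s • y) • shellKernel v K y := by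
    rw [hscale, ← integral_smul, ← integral_smul, ← integral_smul]
    refine integral_congr_ae (ae_of_all _ fun y => ?_)
    rcases eq_or_ne y 0 with rfl | hy0
    · simp [P3, shellKernel, fderiv_bump_eq_zero]
    · simp only [P3, shellKernel, inv_smul_smul₀ hs0, h s hs0 y hy0, abs_of_pos hs, smul_smul]
      congr 1
      field_simp
  have i8 := integrable_comp_smul_smul hf.continuous (integrable_cutKernel hK')
    (fun y hy => cutKernel_eq_zero hy) s
  have i9 := integrable_comp_smul_smul hf.continuous (integrable_shellKernel v hK)
    (fun y hy => shellKernel_eq_zero hy) s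
  have e4 : ∫ y, f (s • y) • (cutKernel K' y + shellKernel v K y) =
      (∫ y, f (s • y) • cutKernel K' y) + ∫ y, f (s • y) • shellKernel v K y := by
    rw [← integral_add i8 i9]
    simp only [smul_add]
  rw [e4, smul_add, smul_add, ← e1, ← e2, ← e3, eq_neg_add_iff_add_eq, add_comm, hint]
  abel

/-- The boundary term is s⁻ⁿ g(s), where g is smooth with parity (-1)^(n+1). Its coefficient of s⁰
vanishes, so no multiple of derivatives of δ appears and differentiation commutes with the finite
part. -/
theorem hasExpansion_setIntegral_deriv {N : ℕ} (hf : ContDiff ℝ (⊤ : ℕ∞) f)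
    (hc : HasCompactSupport f) (hK : ContinuousOn K {0}ᶜ) (hK' : ContinuousOn K' {0}ᶜ)
    (hd : ∀ x, x ≠ 0 → HasLineDerivAt ℝ K (K' x) x v) (h : IsHomogeneousKernel n K) (hN : N ≤ n)
    {L : V} (hL : HasExpansion N (fun s => ∫ x in {x : E m | s < ‖x‖}, fderiv ℝ f x v • K x) L) :
    HasExpansion n (fun s => ∫ x in {x : E m | s < ‖x‖}, f x • K' x) (-L) := by
  have hfv : ContDiff ℝ (⊤ : ℕ∞) fun x => fderiv ℝ f x v :=
    (hf.fderiv_right (m := (⊤ : ℕ∞)) (by norm_cast)).clm_apply contDiff_const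
  have hQ0 : ∀ y : E m, 3 < ‖y‖ → cutKernel K' y + shellKernel v K y = 0 := fun y hy => by
    rw [cutKernel_eq_zero hy, shellKernel_eq_zero hy, add_zero]
  have hg := hasExpansion_of_parity (n := n) (g := fun s =>
      s • (∫ y, fderiv ℝ f (s • y) v • cutKernel K y) +
        ∫ y, f (s • y) • (cutKernel K' y + shellKernel v K y))
    ((contDiff_id.smul (contDiff_integral_comp_smul n hfv (integrable_cutKernel hK)
      fun y hy => cutKernel_eq_zero hy)).add (contDiff_integral_comp_smul n hf
        ((integrable_cutKernel hK').add (integrable_shellKernel v hK)) hQ0)) (by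
      -- Odd-even bookkeeping: `cutKernel K` has parity n and comes with a factor s, while
      -- `cutKernel K'` and `shellKernel v K` have parity n + 1.
      intro s
      rw [integral_comp_neg_smul (f := fun z => fderiv ℝ f z v) (cutKernel_neg h), integral_comp_neg_smul
        (c := (-1 : ℝ) ^ (n + 1)) fun y => by
          rw [cutKernel_neg (h.lineDeriv hd), shellKernel_neg h, smul_add],
        smul_add, smul_smul, smul_smul]
      congr 2
      rw [pow_succ]; ring)
  have hL' := (hL.mono hN).map (-ContinuousLinearMap.id ℝ V)
  have := hL'.add hg
  rw [add_zero] at this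
  refine HasExpansion.congr this fun s hs => ?_
  rw [setIntegral_smul_kernel_add hf hc hK hK' hd h hs]
  rfl

end Kernels

end HalfSpace
end

noncomputable section

namespace HalfSpace

variable {m : ℕ}

/-! ### The Dirac operator on distributions -/

/-- Multiplication by `e_j` from the left. -/
def eMul (m : ℕ) (j : Fin (m + 1)) : Cl m →L[ℝ] Cl m :=
  LinearMap.toContinuousLinearMap (LinearMap.mulLeft ℝ (e m j))

@[simp] theorem eMul_apply (j : Fin (m + 1)) (a : Cl m) : eMul m j a = e m j * a := rfl

/-- The partial derivative of a test function. -/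
def testDeriv (v : E m) (f : TestFunction (⊤ : TopologicalSpace.Opens (E m)) ℝ ⊤) :
    TestFunction (⊤ : TopologicalSpace.Opens (E m)) ℝ ⊤ := LineDeriv.lineDerivOp v f

theorem testDeriv_apply (v : E m) (f : TestFunction (⊤ : TopologicalSpace.Opens (E m)) ℝ ⊤)
    (x : E m) : testDeriv v f x = fderiv ℝ f x v := by
  have h : testDeriv v f x = TestFunction.lineDerivCLM (n := ⊤) (k := ⊤) ℝ v f x := rfl
  rw [h, TestFunction.lineDerivCLM_apply_of_le (by simp)]
  exact ((f.contDiff.differentiable (by simp)) x).lineDeriv_eq_fderiv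

theorem diracD_apply (T : CliffDist m)
    (f : TestFunction (⊤ : TopologicalSpace.Opens (E m)) ℝ ⊤) :
    diracD T f = ∑ j : Fin m, eMul m j.succ (-T (testDeriv (EuclideanSpace.single j 1) f)) := by
  rw [diracD]
  simp [testDeriv]

theorem diracD_smul (c : ℝ) (T : CliffDist m) : diracD (c • T) = c • diracD T := by
  rw [diracD]
  ext f
  simp [diracD_apply, testDeriv, Finset.smul_sum]

theorem diracD_neg (T : CliffDist m) : diracD (-T) = -diracD T := by
  rw [← neg_one_smul ℝ T, diracD_smul, neg_one_smul]

theorem iterate_neg_diracD (n : ℕ) (T : CliffDist m) :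
    (fun T : CliffDist m => -diracD T)^[n] T = (-1 : ℝ) ^ n • diracD^[n] T := by
  induction n with
  | zero => simp
  | succ n ih =>
    rw [Function.iterate_succ_apply', Function.iterate_succ_apply', ih, diracD_smul, pow_succ]
    simp

theorem hasExpansion_diracD {n N : ℕ} {K : E m → Cl m} {K' : Fin m → E m → Cl m}
    (hK : ContinuousOn K {0}ᶜ) (hK' : ∀ j, ContinuousOn (K' j) {0}ᶜ)
    (hd : ∀ j x, x ≠ 0 → HasLineDerivAt ℝ K (K' j x) x (EuclideanSpace.single j 1))
    (h : IsHomogeneousKernel n K) (hN : N ≤ n) {T : CliffDist m}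
    (hT : ∀ f : TestFunction (⊤ : TopologicalSpace.Opens (E m)) ℝ ⊤,
      HasExpansion N (fun s => ∫ x in {x : E m | s < ‖x‖}, f x • K x) (T f))
    (f : TestFunction (⊤ : TopologicalSpace.Opens (E m)) ℝ ⊤) :
    HasExpansion n (fun s => ∫ x in {x : E m | s < ‖x‖}, f x • dirac K x) (diracD T f) := by
  rw [diracD_apply]
  have h1 : ∀ j : Fin m, HasExpansion n
      (fun s => ∫ x in {x : E m | s < ‖x‖}, f x • K' j x)
      (-T (testDeriv (EuclideanSpace.single j 1) f)) := fun j => by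
    refine hasExpansion_setIntegral_deriv f.contDiff f.hasCompactSupport hK (hK' j) (hd j) h hN ?_
    simpa only [testDeriv_apply] using hT (testDeriv (EuclideanSpace.single j 1) f)
  refine (HasExpansion.sum Finset.univ fun j => (h1 j).map (eMul m j.succ)).congr fun s hs => ?_
  have hSm : MeasurableSet {x : E m | s < ‖x‖} := measurableSet_lt measurable_const measurable_norm
  have hi : ∀ j, Integrable (fun x => f x • K' j x) (volume.restrict {x : E m | s < ‖x‖}) :=
    fun j => (integrable_indicator_iff hSm).1
      (integrable_indicator_smul_kernel f.continuous f.hasCompactSupport (hK' j) hs)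
  simp only [← fun j => (eMul m j.succ).integral_comp_comm (hi j)]
  rw [← integral_finsetSum _ fun j _ => (eMul m j.succ).integrable_comp (hi j)]
  refine setIntegral_congr_fun hSm fun x hx => ?_
  have hx0 : x ≠ 0 := norm_pos_iff.1 (hs.trans hx)
  simp only [dirac_eq fun j => hd j x hx0, Finset.smul_sum, eMul_apply, mul_smul_comm]

/-! ### Radial kernels -/

theorem norm_sq_rpow (x : E m) (a : ℕ) : (‖x‖ ^ 2) ^ (-(a / 2 : ℝ)) = (‖x‖ ^ a)⁻¹ := by
  rw [Real.rpow_neg (by positivity), ← Real.rpow_natCast, ← Real.rpow_mul (norm_nonneg x),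
    ← Real.rpow_natCast]
  congr 2; push_cast; ring

theorem hasDerivAt_rpow_norm_sq {x : E m} (hx : x ≠ 0) (a : ℕ) (c : ℝ) :
    HasDerivAt (fun y : ℝ => c * y ^ (-(a / 2 : ℝ))) (c * (-(a / 2 : ℝ) * (‖x‖ ^ (a + 2))⁻¹))
      (‖x‖ ^ 2) := by
  have h : ‖x‖ ^ 2 ≠ 0 := by simpa using hx
  have h1 := (Real.hasDerivAt_rpow_const (p := -(a / 2 : ℝ)) (Or.inl h)).const_mul c
  rwa [show -(a / 2 : ℝ) - 1 = -((a + 2 : ℕ) / 2 : ℝ) by push_cast; ring, norm_sq_rpow] at h1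

/-- The kernel `c / |x|^a`. -/
def scalarKernel (m a : ℕ) (c : ℝ) (x : E m) : Cl m := (c * (‖x‖ ^ a)⁻¹) • 1

/-- The kernel `c x / |x|^a`. -/
def vectorKernel (m a : ℕ) (c : ℝ) (x : E m) : Cl m := (c * (‖x‖ ^ a)⁻¹) • vec x

theorem scalarKernel_eq (a : ℕ) (c : ℝ) : scalarKernel m a c =
    fun x : E m => (fun y : ℝ => c * y ^ (-(a / 2 : ℝ))) (‖x‖ ^ 2) • (1 : Cl m) :=
  funext fun x => by simp only [norm_sq_rpow, scalarKernel]

theorem vectorKernel_eq (a : ℕ) (c : ℝ) : vectorKernel m a c =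
    fun x : E m => (fun y : ℝ => c * y ^ (-(a / 2 : ℝ))) (‖x‖ ^ 2) • vec x :=
  funext fun x => by simp only [norm_sq_rpow, vectorKernel]

theorem dirac_scalarKernel (a : ℕ) (c : ℝ) {x : E m} (hx : x ≠ 0) :
    dirac (scalarKernel m a c) x = vectorKernel m (a + 2) (-(c * a)) x := by
  rw [scalarKernel_eq, dirac_radial_one (hasDerivAt_rpow_norm_sq hx a c), vectorKernel]
  congr 1; ring

theorem dirac_vectorKernel (a : ℕ) (c : ℝ) {x : E m} (hx : x ≠ 0) :
    dirac (vectorKernel m a c) x = scalarKernel m a (c * (a - m)) x := by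
  have h : ‖x‖ ≠ 0 := by simpa using hx
  rw [vectorKernel_eq, dirac_radial_vec (hasDerivAt_rpow_norm_sq hx a c), scalarKernel,
    norm_sq_rpow]
  congr 1; field_simp; ring

theorem continuousOn_norm_inv (a : ℕ) (c : ℝ) :
    ContinuousOn (fun x : E m => c * (‖x‖ ^ a)⁻¹) {0}ᶜ :=
  continuousOn_const.mul ((continuous_norm.pow a).continuousOn.inv₀ fun _ hx =>
    pow_ne_zero _ (norm_ne_zero_iff.2 hx))

theorem continuous_vec : Continuous (vec : E m → Cl m) := (vecCLM m).continuous

theorem continuousOn_scalarKernel (a : ℕ) (c : ℝ) : ContinuousOn (scalarKernel m a c) {0}ᶜ :=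
  (continuousOn_norm_inv a c).smul (continuousOn_const (c := (1 : Cl m)))

theorem continuousOn_vectorKernel (a : ℕ) (c : ℝ) : ContinuousOn (vectorKernel m a c) {0}ᶜ :=
  (continuousOn_norm_inv a c).smul continuous_vec.continuousOn

/-- Scalar kernels are even functions and vector kernels odd ones, so degree 1-m-n goes with the
required parity only for n even here and n odd below. ∂ raises n by one and exchanges the two types.
-/
theorem isHomogeneousKernel_scalarKernel {a n : ℕ} (hn : Even n) (ha : a + 1 = m + n) (c : ℝ) :
    IsHomogeneousKernel n (scalarKernel m a c) := by
  intro s hs x hx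
  rw [scalarKernel, scalarKernel, smul_smul, norm_smul, Real.norm_eq_abs, ← hn.pow_abs s,
    ← pow_add, ← ha, pow_succ, mul_pow]
  have : |s| ≠ 0 := by simpa using hs
  congr 1; field_simp

theorem isHomogeneousKernel_vectorKernel {a n : ℕ} (hn : Odd n) (ha : a = m + n) (c : ℝ) :
    IsHomogeneousKernel n (vectorKernel m a c) := by
  intro s hs x hx
  have hv : vec (s • x) = s • vec x := (vecCLM m).map_smul s x
  obtain ⟨l, rfl⟩ := hn
  have h1 : |s| ^ 2 = s ^ 2 := sq_abs s
  have h2 : |s| ^ (2 * l) = s ^ (2 * l) := by rw [pow_mul, h1, pow_mul]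
  rw [vectorKernel, vectorKernel, hv, smul_smul, smul_smul, norm_smul, Real.norm_eq_abs, ha,
    mul_pow, pow_add |s|, pow_succ |s|, h2, pow_succ s]
  have : |s| ≠ 0 := by simpa using hs
  congr 1
  field_simp
  rw [h1]

theorem hasExpansion_diracD_scalarKernel {a n N : ℕ} (hn : Even n) (ha : a + 1 = m + n) {c : ℝ}
    (hN : N ≤ n) {T : CliffDist m}
    (hT : ∀ f : TestFunction (⊤ : TopologicalSpace.Opens (E m)) ℝ ⊤,
      HasExpansion N (fun s => ∫ x in {x : E m | s < ‖x‖}, f x • scalarKernel m a c x) (T f))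
    (f : TestFunction (⊤ : TopologicalSpace.Opens (E m)) ℝ ⊤) :
    HasExpansion n (fun s => ∫ x in {x : E m | s < ‖x‖},
      f x • vectorKernel m (a + 2) (-(c * a)) x) (diracD T f) := by
  refine (hasExpansion_diracD (K' := fun j x =>
    (2 * x j * (c * (-(a / 2 : ℝ) * (‖x‖ ^ (a + 2))⁻¹))) • 1) (continuousOn_scalarKernel a c)
    (fun j => ?_) (fun j x hx => ?_) (isHomogeneousKernel_scalarKernel hn ha c) hN hT f).congr
    fun s hs => ?_
  · have := continuousOn_norm_inv (m := m) (a + 2) (-(a / 2 : ℝ))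
    have h2 : Continuous fun x : E m => 2 * x j := by fun_prop
    exact (h2.continuousOn.mul (continuousOn_const.mul this)).smul
      (continuousOn_const (c := (1 : Cl m)))
  · rw [scalarKernel_eq]
    exact hasLineDerivAt_radial_one (hasDerivAt_rpow_norm_sq hx a c) j
  · refine setIntegral_congr_fun (measurableSet_lt measurable_const measurable_norm) fun x hx => ?_
    rw [dirac_scalarKernel a c (norm_pos_iff.1 (hs.trans hx))]

theorem hasExpansion_diracD_vectorKernel {a n N : ℕ} (hn : Odd n) (ha : a = m + n) {c : ℝ}
    (hN : N ≤ n) {T : CliffDist m}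
    (hT : ∀ f : TestFunction (⊤ : TopologicalSpace.Opens (E m)) ℝ ⊤,
      HasExpansion N (fun s => ∫ x in {x : E m | s < ‖x‖}, f x • vectorKernel m a c x) (T f))
    (f : TestFunction (⊤ : TopologicalSpace.Opens (E m)) ℝ ⊤) :
    HasExpansion n (fun s => ∫ x in {x : E m | s < ‖x‖},
      f x • scalarKernel m a (c * n) x) (diracD T f) := by
  refine (hasExpansion_diracD (K' := fun j x =>
    (c * (‖x‖ ^ a)⁻¹) • e m j.succ + (2 * x j * (c * (-(a / 2 : ℝ) * (‖x‖ ^ (a + 2))⁻¹))) • vec x)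
    (continuousOn_vectorKernel a c)
    (fun j => ?_) (fun j x hx => ?_) (isHomogeneousKernel_vectorKernel hn ha c) hN hT f).congr
    fun s hs => ?_
  · have := continuousOn_norm_inv (m := m) (a + 2) (-(a / 2 : ℝ))
    have h2 : Continuous fun x : E m => 2 * x j := by fun_prop
    exact ((continuousOn_norm_inv a c).smul continuousOn_const).add
      ((h2.continuousOn.mul (continuousOn_const.mul this)).smul continuous_vec.continuousOn)
  · rw [vectorKernel_eq]
    have := hasLineDerivAt_radial_vec (hasDerivAt_rpow_norm_sq hx a c) j
    simpa only [norm_sq_rpow] using this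
  · refine setIntegral_congr_fun (measurableSet_lt measurable_const measurable_norm) fun x hx => ?_
    rw [dirac_vectorKernel a c (norm_pos_iff.1 (hs.trans hx)), ha]
    push_cast; ring_nf

end HalfSpace
end

noncomputable section

namespace HalfSpace

variable {m : ℕ}

/-! ### Boundary values -/

theorem integrable_smul_of_continuous
    (f : TestFunction (⊤ : TopologicalSpace.Opens (E m)) ℝ ⊤) {F : E m → Cl m}
    (hF : Continuous F) : Integrable fun x => f x • F x :=
  (f.continuous.smul hF).integrable_of_hasCompactSupport f.hasCompactSupport.smul_right

theorem IsBoundaryValue.congr {F G : ℝ → E m → Cl m} {T : CliffDist m} (hF : IsBoundaryValue F T)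
    (h : ∀ t, 0 < t → ∀ x, F t x = G t x) : IsBoundaryValue G T := by
  intro f
  refine ⟨fun t ht => ?_, (hF f).2.congr' ?_⟩
  · rw [← funext (h t ht)]; exact (hF f).1 t ht
  · filter_upwards [self_mem_nhdsWithin] with t ht
    rw [funext (h t ht)]

theorem integral_smul_lineDeriv (f : TestFunction (⊤ : TopologicalSpace.Opens (E m)) ℝ ⊤)
    {F : E m → Cl m} (hF : ContDiff ℝ 1 F) (v : E m) :
    ∫ x, f x • fderiv ℝ F x v = -∫ x, testDeriv v f x • F x := by
  have h1 : Continuous fun x => fderiv ℝ F x v :=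
    (hF.continuous_fderiv one_ne_zero).clm_apply continuous_const
  refine integral_bilinear_hasLineDerivAt_right_eq_neg_left_of_integrable
    (B := ContinuousLinearMap.lsmul ℝ ℝ)
    (integrable_smul_of_continuous (testDeriv v f) hF.continuous)
    (integrable_smul_of_continuous f h1) (integrable_smul_of_continuous f hF.continuous)
    (fun x _ => ?_) fun x _ => (hF.differentiable one_ne_zero x).hasFDerivAt.hasLineDerivAt v
  rw [testDeriv_apply]
  exact (f.contDiff.differentiable (by simp) x).hasFDerivAt.hasLineDerivAt v

/-- For fixed x₀ > 0 integration by parts moves each ∂_j to the test function, to which the limit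
for `F` then applies. -/
theorem IsBoundaryValue.neg_dirac {F G : ℝ → E m → Cl m} {T : CliffDist m}
    (hF : IsBoundaryValue F T) (hc : ∀ t, 0 < t → ContDiff ℝ 1 (F t))
    (hG : ∀ t, 0 < t → ∀ x, dirac (F t) x = -G t x) : IsBoundaryValue G (-diracD T) := by
  have hG' : ∀ t, 0 < t → ∀ x, G t x =
      -∑ j : Fin m, eMul m j.succ (fderiv ℝ (F t) x (EuclideanSpace.single j 1)) := by
    intro t ht x
    rw [eq_neg_iff_add_eq_zero, add_comm, ← eq_neg_iff_add_eq_zero, ← hG t ht x]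
    exact (dirac_eq fun j =>
      ((hc t ht).differentiable one_ne_zero x).hasFDerivAt.hasLineDerivAt _).symm
  have hcd : ∀ t, 0 < t → ∀ j : Fin m,
      Continuous fun x => fderiv ℝ (F t) x (EuclideanSpace.single j 1) := fun t ht j =>
    ((hc t ht).continuous_fderiv one_ne_zero).clm_apply continuous_const
  intro f
  constructor
  · intro t ht
    refine integrable_smul_of_continuous f ?_
    rw [funext (hG' t ht)]
    exact (continuous_finsetSum _ fun j _ => (eMul m j.succ).continuous.comp (hcd t ht j)).neg
  · have h1 : (-diracD T) f =
        ∑ j : Fin m, eMul m j.succ (T (testDeriv (EuclideanSpace.single j 1) f)) := by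
      have : (-diracD T) f = -(diracD T f) := rfl
      rw [this, diracD_apply, ← Finset.sum_neg_distrib]
      simp
    rw [h1]
    refine (tendsto_finsetSum _ fun j _ => ((eMul m j.succ).continuous.tendsto _).comp
      (hF (testDeriv (EuclideanSpace.single j 1) f)).2).congr' ?_
    filter_upwards [self_mem_nhdsWithin] with t ht
    have hi : ∀ j : Fin m, Integrable fun x =>
        f x • fderiv ℝ (F t) x (EuclideanSpace.single j 1) := fun j =>
      integrable_smul_of_continuous f (hcd t ht j)
    have hi' : ∀ j : Fin m, Integrable fun x =>
        -(f x • fderiv ℝ (F t) x (EuclideanSpace.single j 1)) := fun j => (hi j).neg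
    have h2 : ∀ x, f x • G t x =
        ∑ j : Fin m, eMul m j.succ (-(f x • fderiv ℝ (F t) x (EuclideanSpace.single j 1))) := by
      intro x
      rw [hG' t ht, smul_neg, Finset.smul_sum, ← Finset.sum_neg_distrib]
      refine Finset.sum_congr rfl fun j _ => ?_
      rw [map_neg, map_smul]
    rw [integral_congr_ae (ae_of_all _ h2),
      integral_finsetSum _ fun j _ => (eMul m j.succ).integrable_comp (hi' j)]
    refine Finset.sum_congr rfl fun j _ => ?_
    rw [(eMul m j.succ).integral_comp_comm (hi' j), integral_neg,
      integral_smul_lineDeriv f (hc t ht), neg_neg]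
    rfl

theorem locallyIntegrable_scalarKernel (hm : 2 ≤ m) (c : ℝ) :
    LocallyIntegrable (scalarKernel m (m - 1) c) := by
  have h1 : (m - 1 : ℕ) + (1 : ℝ) = m := by
    have : m - 1 + 1 = m := by omega
    exact_mod_cast this
  refine locallyIntegrable_of_norm_le_rpow (C := |c| * ‖(1 : Cl m)‖) (α := (m - 1 : ℕ))
    (by rw [finrank_euclideanSpace_fin]; omega) (by rw [finrank_euclideanSpace_fin]; linarith)
    (ae_of_all _ fun x => ?_) ?_
  · rw [scalarKernel, norm_smul, norm_mul, Real.norm_eq_abs, norm_inv, norm_pow, norm_norm,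
      Real.rpow_neg (norm_nonneg x), Real.rpow_natCast]
    exact le_of_eq (by ring)
  · have : Measurable fun x : E m => c * (‖x‖ ^ (m - 1))⁻¹ := by fun_prop
    exact this.aestronglyMeasurable.smul_const _

/-- The value at `x₀ = 0` of the potential `A_0`. -/
def boundaryKernel (m : ℕ) : E m → Cl m :=
  scalarKernel m (m - 1) (-(1 / (sphereArea (m + 1) * halfExp m)))

/-- The distribution `boundaryKernel`. -/
def boundaryDist (m : ℕ) : CliffDist m :=
  TestFunction.integralAgainstBilinCLM (ContinuousLinearMap.lsmul ℝ ℝ) volume (boundaryKernel m)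

theorem boundaryDist_apply (hm : 2 ≤ m)
    (f : TestFunction (⊤ : TopologicalSpace.Opens (E m)) ℝ ⊤) :
    boundaryDist m f = ∫ x, f x • boundaryKernel m x :=
  TestFunction.integralAgainstBilinCLM_eq_integral
    ((locallyIntegrable_scalarKernel hm _).locallyIntegrableOn _)

theorem integrable_smul_boundaryKernel (hm : 2 ≤ m)
    (f : TestFunction (⊤ : TopologicalSpace.Opens (E m)) ℝ ⊤) :
    Integrable fun x => f x • boundaryKernel m x :=
  f.integrable_bilin (ContinuousLinearMap.lsmul ℝ ℝ)
    ((locallyIntegrable_scalarKernel hm _).locallyIntegrableOn _)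

theorem ae_ne_zero (hm : 2 ≤ m) : ∀ᵐ x : E m, x ≠ 0 := by
  have : Nontrivial (E m) := Module.nontrivial_of_finrank_pos (R := ℝ)
    (by rw [finrank_euclideanSpace_fin]; omega)
  simp [ae_iff]

theorem hasExpansion_boundaryDist (hm : 2 ≤ m)
    (f : TestFunction (⊤ : TopologicalSpace.Opens (E m)) ℝ ⊤) :
    HasExpansion 0 (fun s => ∫ x in {x : E m | s < ‖x‖}, f x • boundaryKernel m x)
      (boundaryDist m f) := by
  have hi := integrable_smul_boundaryKernel hm f
  have hS : ∀ s : ℝ, MeasurableSet {x : E m | s < ‖x‖} := fun s =>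
    measurableSet_lt measurable_const measurable_norm
  rw [hasExpansion_zero_iff, boundaryDist_apply hm]
  simp only [← integral_indicator (hS _)]
  refine tendsto_integral_filter_of_dominated_convergence _
    (.of_forall fun s => hi.aestronglyMeasurable.indicator (hS s))
    (.of_forall fun s => ae_of_all _ fun x => norm_indicator_le_norm_self _ _) hi.norm ?_
  filter_upwards [ae_ne_zero hm] with x hx
  refine tendsto_const_nhds.congr' ?_
  filter_upwards [nhdsWithin_le_nhds (gt_mem_nhds (norm_pos_iff.2 hx))] with s hs
  rw [indicator_of_mem (show x ∈ {x : E m | s < ‖x‖} from hs)]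

/-- The bound (t² + |x|²)^(-p) ≤ |x|^(-2p) makes the locally integrable boundary kernel itself the
dominating function. -/
theorem isBoundaryValue_potA_zero (hm : 2 ≤ m) : IsBoundaryValue (potA m 0) (boundaryDist m) := by
  intro f
  refine ⟨fun t ht => integrable_smul_of_continuous f (contDiff_potA 0 ht).continuous, ?_⟩
  rw [boundaryDist_apply hm]
  have hp := halfExp_pos hm
  have hm1 : ((m - 1 : ℕ) : ℝ) / 2 = halfExp m := by
    rw [halfExp, Nat.cast_sub (by omega)]; simp
  have hK : ∀ x : E m, boundaryKernel m x =
      (-(1 / (sphereArea (m + 1) * halfExp m)) * (‖x‖ ^ 2) ^ (-halfExp m)) • 1 := by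
    intro x
    rw [boundaryKernel, scalarKernel, ← norm_sq_rpow, hm1]
  refine tendsto_integral_filter_of_dominated_convergence _ ?_ ?_
    (integrable_smul_boundaryKernel hm f).norm ?_
  · filter_upwards [self_mem_nhdsWithin] with t ht
    exact (integrable_smul_of_continuous f (contDiff_potA 0 ht).continuous).aestronglyMeasurable
  · filter_upwards [self_mem_nhdsWithin] with t ht
    filter_upwards [ae_ne_zero hm] with x hx
    have hx2 : 0 < ‖x‖ ^ 2 := by positivity
    rw [norm_smul, norm_smul, hK, potA, powDeriv_zero, norm_smul, norm_smul, norm_mul, norm_mul,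
      Real.norm_of_nonneg (by positivity : 0 ≤ (t ^ 2 + ‖x‖ ^ 2) ^ (-halfExp m)),
      Real.norm_of_nonneg (by positivity : 0 ≤ (‖x‖ ^ 2) ^ (-halfExp m))]
    gcongr ‖f x‖ * (_ * ?_ * _)
    exact Real.rpow_le_rpow_of_nonpos hx2 (by nlinarith [sq_nonneg t]) (by linarith)
  · filter_upwards [ae_ne_zero hm] with x hx
    have hx2 : ‖x‖ ^ 2 ≠ 0 := by positivity
    have h1 : ContinuousAt (fun t : ℝ => (t ^ 2 + ‖x‖ ^ 2) ^ (-halfExp m)) 0 :=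
      ContinuousAt.rpow_const (by fun_prop) (Or.inl (by simpa using hx))
    have h2 := (((h1.tendsto.mono_left (nhdsWithin_le_nhds (s := Ioi 0))).const_mul
      (-(1 / (sphereArea (m + 1) * halfExp m)))).smul_const (1 : Cl m)).const_smul (f x)
    simp only [hK, potA, powDeriv_zero]
    simpa using h2

/-! ### The Poisson kernel as an approximate identity. -/

/-- The Poisson kernel at `x₀ = 1`. -/
def poisson (m : ℕ) (x : E m) : ℝ := 2 / sphereArea (m + 1) * (1 + ‖x‖ ^ 2) ^ (-(halfExp m + 1))

theorem potA_one_eq (hm : 2 ≤ m) {t : ℝ} (ht : 0 < t) (x : E m) :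
    potA m 1 t x = (t⁻¹ ^ m * poisson m (t⁻¹ • x)) • (1 : Cl m) := by
  have hp := halfExp_pos hm
  have hσ := sphereArea_pos (Nat.succ_pos m)
  have h1 : 1 + ‖t⁻¹ • x‖ ^ 2 = t⁻¹ ^ 2 * (t ^ 2 + ‖x‖ ^ 2) := by
    rw [norm_smul, norm_inv, Real.norm_eq_abs, mul_pow, inv_pow, sq_abs]; field_simp
  have h2 : (t⁻¹ ^ 2) ^ (-(halfExp m + 1)) = t ^ (m + 1) := by
    rw [inv_pow, Real.inv_rpow (by positivity), ← Real.rpow_neg (by positivity), neg_neg,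
      ← Real.rpow_natCast, ← Real.rpow_mul ht.le, ← Real.rpow_natCast]
    congr 1; unfold halfExp; push_cast; ring
  rw [potA, poisson, h1, Real.mul_rpow (by positivity) (by positivity), h2, powDeriv_one]
  congr 1
  rw [pow_succ, inv_pow]
  field_simp
  ring

theorem isBoundaryValue_potA_one (hm : 2 ≤ m) (hP : ∫ x, poisson m x = 1) :
    IsBoundaryValue (potA m 1) (delta m) := by
  have hp := halfExp_pos hm
  have hσ := sphereArea_pos (Nat.succ_pos m)
  intro f
  refine ⟨fun t ht => integrable_smul_of_continuous f (contDiff_potA 1 ht).continuous, ?_⟩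
  -- The kernel decays like |x|^(-m-1), one power better than the approximate-identity theorem
  -- requires; that theorem is applied with scale t⁻¹ → ∞.
  have hlim : Tendsto (fun x : E m => ‖x‖ ^ Module.finrank ℝ (E m) * poisson m x)
      (Bornology.cobounded (E m)) (𝓝 0) := by
    have h1 : Tendsto (fun x : E m => 2 / sphereArea (m + 1) * ‖x‖⁻¹)
        (Bornology.cobounded (E m)) (𝓝 0) := by
      simpa using (tendsto_inv_atTop_zero.comp tendsto_norm_cobounded_atTop).const_mul
        (2 / sphereArea (m + 1))
    refine tendsto_of_tendsto_of_tendsto_of_le_of_le' tendsto_const_nhds h1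
      (.of_forall fun x => by unfold poisson; positivity) ?_
    filter_upwards [tendsto_norm_cobounded_atTop.eventually_gt_atTop 0] with x hx
    rw [finrank_euclideanSpace_fin, poisson, mul_left_comm]
    gcongr
    have h2 : (1 + ‖x‖ ^ 2) ^ (-(halfExp m + 1)) ≤ (‖x‖ ^ 2) ^ (-(halfExp m + 1)) :=
      Real.rpow_le_rpow_of_nonpos (by positivity) (by linarith) (by linarith)
    have h3 : (‖x‖ ^ 2) ^ (-(halfExp m + 1)) = (‖x‖ ^ (m + 1))⁻¹ := by
      rw [← norm_sq_rpow]; congr 1; unfold halfExp; push_cast; ring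
    refine (mul_le_mul_of_nonneg_left (h2.trans_eq h3) (by positivity)).trans_eq ?_
    rw [pow_succ]; field_simp
  have hf : Integrable fun x => f x • (1 : Cl m) := integrable_smul_of_continuous f continuous_const
  have hfc : Continuous fun x => f x • (1 : Cl m) :=
    f.continuous.smul (continuous_const (y := (1 : Cl m)))
  have h := (tendsto_integral_comp_smul_smul_of_integrable
    (fun x => by unfold poisson; positivity) hP hlim hf
    hfc.continuousAt).comp tendsto_inv_nhdsGT_zero
  refine h.congr' ?_
  filter_upwards [self_mem_nhdsWithin] with t ht
  refine integral_congr_ae (ae_of_all _ fun x => ?_)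
  simp only [potA_one_eq hm ht, finrank_euclideanSpace_fin]
  rw [smul_comm]

theorem integral_poisson_two : ∫ x, poisson 2 x = 1 := by
  have h1 : ∫ y in Ioi (0 : ℝ), y * (1 + y ^ 2) ^ (-(3 / 2) : ℝ) = 1 := by
    have hd : ∀ y ∈ Ici (0 : ℝ), HasDerivAt (fun y : ℝ => -(1 + y ^ 2) ^ (-(1 / 2) : ℝ))
        (y * (1 + y ^ 2) ^ (-(3 / 2) : ℝ)) y := by
      intro y _
      have h := (((hasDerivAt_pow 2 y).const_add 1).rpow_const (p := -(1 / 2))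
        (Or.inl (by positivity))).neg
      refine h.congr_deriv ?_
      rw [show (-(1 / 2) - 1 : ℝ) = -(3 / 2) by norm_num]
      push_cast; ring
    have hl : Tendsto (fun y : ℝ => -(1 + y ^ 2) ^ (-(1 / 2) : ℝ)) atTop (𝓝 (-0)) := by
      refine ((tendsto_rpow_neg_atTop (by norm_num : (0 : ℝ) < 1 / 2)).comp ?_).neg
      exact tendsto_atTop_add_const_left _ _ (tendsto_pow_atTop two_ne_zero)
    rw [integral_Ioi_of_hasDerivAt_of_nonneg' hd (fun y hy => by
      have : 0 < y := hy
      positivity) hl]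
    norm_num
  -- Polar coordinates: the sphere appears as the dimension times the volume of the unit ball.
  have h2 := integral_fun_norm_addHaar (volume : Measure (E 2))
    fun y : ℝ => 2 / sphereArea 3 * (1 + y ^ 2) ^ (-(3 / 2) : ℝ)
  have hπ := Real.pi_pos
  simp only [finrank_euclideanSpace_fin, Measure.real, EuclideanSpace.volume_ball_fin_two] at h2
  have h3 : ∀ x : E 2, poisson 2 x = 2 / sphereArea 3 * (1 + ‖x‖ ^ 2) ^ (-(3 / 2) : ℝ) := by
    intro x
    rw [poisson, halfExp_two]; norm_num
  rw [integral_congr_ae (ae_of_all _ h3), h2, sphereArea_three]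
  have h4 : ∀ y : ℝ, y ^ (2 - 1) • (2 / (4 * Real.pi) * (1 + y ^ 2) ^ (-(3 / 2) : ℝ)) =
      2 / (4 * Real.pi) * (y * (1 + y ^ 2) ^ (-(3 / 2) : ℝ)) := fun y => by
    simp only [smul_eq_mul]; ring
  simp only [h4, integral_const_mul, h1]
  simp [ENNReal.toReal_ofReal hπ.le]
  field_simp
  norm_num

theorem integral_poisson_three : ∫ x, poisson 3 x = 1 := by
  have h1 : ∫ y in Ioi (0 : ℝ), y ^ 2 / (1 + y ^ 2) ^ 2 = Real.pi / 4 := by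
    have hd : ∀ y ∈ Ici (0 : ℝ), HasDerivAt (fun y : ℝ => (Real.arctan y - y / (1 + y ^ 2)) / 2)
        (y ^ 2 / (1 + y ^ 2) ^ 2) y := by
      intro y _
      have h0 : (1 + y ^ 2 : ℝ) ≠ 0 := by positivity
      have h := ((Real.hasDerivAt_arctan y).sub ((hasDerivAt_id y).div
        ((hasDerivAt_pow 2 y).const_add 1) h0)).div_const 2
      refine h.congr_deriv ?_
      simp only [id]
      field_simp
      push_cast; ring
    have hl : Tendsto (fun y : ℝ => (Real.arctan y - y / (1 + y ^ 2)) / 2) atTop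
        (𝓝 ((Real.pi / 2 - 0) / 2)) := by
      refine ((tendsto_nhds_of_tendsto_nhdsWithin Real.tendsto_arctan_atTop).sub ?_).div_const 2
      refine tendsto_of_tendsto_of_tendsto_of_le_of_le' tendsto_const_nhds tendsto_inv_atTop_zero
        ?_ ?_
      · filter_upwards [eventually_ge_atTop 0] with y hy
        positivity
      · filter_upwards [eventually_gt_atTop 0] with y hy
        rw [div_le_iff₀ (by positivity)]
        field_simp
        nlinarith
    rw [integral_Ioi_of_hasDerivAt_of_nonneg' hd (fun y _ => by positivity) hl]
    simp; ring
  have h2 := integral_fun_norm_addHaar (volume : Measure (E 3))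
    fun y : ℝ => 2 / sphereArea 4 * ((1 + y ^ 2) ^ 2)⁻¹
  have hπ := Real.pi_pos
  simp only [finrank_euclideanSpace_fin, Measure.real, EuclideanSpace.volume_ball_fin_three] at h2
  have h3 : ∀ x : E 3, poisson 3 x = 2 / sphereArea 4 * ((1 + ‖x‖ ^ 2) ^ 2)⁻¹ := by
    intro x
    rw [poisson, halfExp_three, show (1 + 1 : ℝ) = (2 : ℕ) by norm_num,
      Real.rpow_neg (by positivity), Real.rpow_natCast]
  rw [integral_congr_ae (ae_of_all _ h3), h2, sphereArea_four]
  have h4 : ∀ y : ℝ, y ^ (3 - 1) • (2 / (2 * Real.pi ^ 2) * ((1 + y ^ 2) ^ 2)⁻¹) =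
      2 / (2 * Real.pi ^ 2) * (y ^ 2 / (1 + y ^ 2) ^ 2) := fun y => by
    simp only [smul_eq_mul, div_eq_mul_inv]; ring
  simp only [h4, integral_const_mul, h1]
  simp [ENNReal.toReal_ofReal (by positivity : 0 ≤ Real.pi * 4 / 3)]
  field_simp

end HalfSpace
end

noncomputable section

namespace HalfSpace

variable {m : ℕ}

/-! ### The Hilbert kernel, iterates of the Dirac operator and their finite parts. -/

/-- The Hilbert kernel. -/
def hilbert (m : ℕ) : CliffDist m := -diracD (boundaryDist m)

/-- The coefficients of the finite parts `∂^{2ℓ}` of `boundaryDist`. -/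
def fpCoeff (m : ℕ) : ℕ → ℝ
  | 0 => -(1 / (sphereArea (m + 1) * halfExp m))
  -- ∂ takes c/|x|^a to -ca x/|x|^(a+2) with a = m-1+2ℓ, and a second ∂ multiplies by a + 2 - m =
  -- 2ℓ+1.
  | ℓ + 1 => -(fpCoeff m ℓ * (m - 1 + 2 * ℓ : ℕ)) * (2 * ℓ + 1 : ℕ)

theorem hasExpansion_iterate_odd (hm : 2 ≤ m) {ℓ N : ℕ} (hN : N ≤ 2 * ℓ)
    (h : ∀ f : TestFunction (⊤ : TopologicalSpace.Opens (E m)) ℝ ⊤, HasExpansion N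
      (fun s => ∫ x in {x : E m | s < ‖x‖}, f x • scalarKernel m (m - 1 + 2 * ℓ) (fpCoeff m ℓ) x)
      (diracD^[2 * ℓ] (boundaryDist m) f))
    (f : TestFunction (⊤ : TopologicalSpace.Opens (E m)) ℝ ⊤) :
    HasExpansion (2 * ℓ) (fun s => ∫ x in {x : E m | s < ‖x‖},
      f x • vectorKernel m (m - 1 + 2 * ℓ + 2) (-(fpCoeff m ℓ * (m - 1 + 2 * ℓ : ℕ))) x)
      (diracD^[2 * ℓ + 1] (boundaryDist m) f) := by
  rw [Function.iterate_succ_apply']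
  exact hasExpansion_diracD_scalarKernel (by simp) (by omega) hN h f

/-- Induction by two applications of ∂, scalar to vector to scalar. The order `2 * ℓ - 1` is
truncated to 0 at ℓ = 0, where the kernel is locally integrable. -/
theorem hasExpansion_iterate_even (hm : 2 ≤ m) : ∀ (ℓ : ℕ)
    (f : TestFunction (⊤ : TopologicalSpace.Opens (E m)) ℝ ⊤), HasExpansion (2 * ℓ - 1)
      (fun s => ∫ x in {x : E m | s < ‖x‖}, f x • scalarKernel m (m - 1 + 2 * ℓ) (fpCoeff m ℓ) x)
      (diracD^[2 * ℓ] (boundaryDist m) f)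
  | 0, f => hasExpansion_boundaryDist hm f
  | ℓ + 1, f => by
    have h := hasExpansion_diracD_vectorKernel (n := 2 * ℓ + 1) (by simp) (by omega) (by omega)
      (hasExpansion_iterate_odd hm (by omega) (hasExpansion_iterate_even hm ℓ)) f
    rwa [← Function.iterate_succ_apply' (diracD (m := m))] at h

theorem vectorKernel_succ (a : ℕ) (c : ℝ) :
    vectorKernel m (a + 1) c = fun x => (c * (‖x‖ ^ a)⁻¹) • omega x := by
  funext x
  rw [vectorKernel, omega, smul_smul, pow_succ, mul_inv, mul_assoc]

/-- The odd powers of the Dirac operator applied to the Hilbert kernel. -/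
theorem iterate_neg_diracD_hilbert (ℓ : ℕ) :
    (fun T : CliffDist m => -diracD T)^[2 * ℓ + 1] (hilbert m) =
      diracD^[2 * (ℓ + 1)] (boundaryDist m) := by
  rw [iterate_neg_diracD, hilbert, ← neg_one_smul ℝ (diracD (boundaryDist m)),
    show 2 * (ℓ + 1) = 2 * ℓ + 1 + 1 by ring, Function.iterate_succ_apply diracD (2 * ℓ + 1)]
  have h : ∀ (n : ℕ) (T : CliffDist m), diracD^[n] ((-1 : ℝ) • T) = (-1 : ℝ) • diracD^[n] T := by
    intro n T
    induction n with
    | zero => rfl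
    | succ n ih => rw [Function.iterate_succ_apply', Function.iterate_succ_apply', ih, diracD_smul]
  rw [h, smul_smul, pow_succ, pow_mul]
  simp

theorem iterate_diracD_neg (n : ℕ) (T : CliffDist m) : diracD^[n] (-T) = -diracD^[n] T := by
  induction n with
  | zero => rfl
  | succ n ih => rw [Function.iterate_succ_apply', Function.iterate_succ_apply', ih, diracD_neg]

theorem iterate_diracD_hilbert (n : ℕ) :
    diracD^[n] (hilbert m) = -diracD^[n + 1] (boundaryDist m) := by
  rw [hilbert, iterate_diracD_neg, Function.iterate_succ_apply]

/-- A distribution with the expansion of a multiple of `K` is a multiple of the finite part. -/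
theorem exists_isFinitePart {N : ℕ} {K : E m → Cl m} {c : ℝ} (hc : c ≠ 0) {S : CliffDist m}
    (h : ∀ f : TestFunction (⊤ : TopologicalSpace.Opens (E m)) ℝ ⊤,
      HasExpansion N (fun s => ∫ x in {x : E m | s < ‖x‖}, f x • (c • K x)) (S f)) :
    ∃ T : CliffDist m, IsFinitePart K T ∧ S = c • T := by
  refine ⟨c⁻¹ • S, fun f => ?_, by rw [smul_inv_smul₀ hc]⟩
  have h1 := (h f).map (c⁻¹ • ContinuousLinearMap.id ℝ (Cl m))
  refine HasExpansion.hasFinitePart (N := N) (h1.congr fun s _ => ?_)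
  simp only [smul_comm _ c, integral_smul]
  simp [smul_inv_smul₀ hc]

theorem exists_isFinitePart_scalar (hm : 2 ≤ m) {ℓ : ℕ} (hℓ : 1 ≤ ℓ) (hc : fpCoeff m ℓ ≠ 0) :
    ∃ T : CliffDist m, IsFinitePart (fun x => (‖x‖ ^ (m - 1 + 2 * ℓ))⁻¹ • (1 : Cl m)) T ∧
      (fun T : CliffDist m => -diracD T)^[2 * ℓ - 1] (hilbert m) = fpCoeff m ℓ • T := by
  obtain ⟨l, rfl⟩ : ∃ l, ℓ = l + 1 := ⟨ℓ - 1, by omega⟩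
  rw [show 2 * (l + 1) - 1 = 2 * l + 1 by omega, iterate_neg_diracD_hilbert]
  refine exists_isFinitePart (N := 2 * (l + 1) - 1) hc fun f => ?_
  simpa only [scalarKernel, smul_smul] using hasExpansion_iterate_even hm (l + 1) f

theorem hasExpansion_hilbert (hm : 2 ≤ m) (ℓ : ℕ)
    (f : TestFunction (⊤ : TopologicalSpace.Opens (E m)) ℝ ⊤) :
    HasExpansion (2 * ℓ) (fun s => ∫ x in {x : E m | s < ‖x‖},
      f x • ((fpCoeff m ℓ * (m - 1 + 2 * ℓ : ℕ)) • ((‖x‖ ^ (m + 2 * ℓ))⁻¹ • omega x)))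
      (diracD^[2 * ℓ] (hilbert m) f) := by
  have h1 := (hasExpansion_iterate_odd hm (by omega) (hasExpansion_iterate_even hm ℓ) f).map
    (-ContinuousLinearMap.id ℝ (Cl m))
  rw [iterate_diracD_hilbert]
  refine HasExpansion.congr h1 fun s _ => ?_
  rw [show m - 1 + 2 * ℓ + 2 = m + 2 * ℓ + 1 by omega, vectorKernel_succ]
  simp [integral_neg, smul_smul]

theorem exists_isFinitePart_vector (hm : 2 ≤ m) {ℓ : ℕ} (hc : fpCoeff m ℓ ≠ 0) :
    ∃ T : CliffDist m, IsFinitePart (fun x => (‖x‖ ^ (m + 2 * ℓ))⁻¹ • omega x) T ∧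
      diracD^[2 * ℓ] (hilbert m) = (fpCoeff m ℓ * (m - 1 + 2 * ℓ : ℕ)) • T := by
  refine exists_isFinitePart (mul_ne_zero hc ?_) (hasExpansion_hilbert hm ℓ)
  exact_mod_cast (by omega : m - 1 + 2 * ℓ ≠ 0)

/-- The case ℓ = 0 of `hasExpansion_hilbert`: the expansion has order 0, so there are no divergent
terms to remove. -/
theorem isPrincipalValue_hilbert (hm : 2 ≤ m) :
    IsPrincipalValue (fun x => (-(2 / sphereArea (m + 1)) * (‖x‖ ^ m)⁻¹) • omega x)
      (hilbert m) := by
  intro f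
  have h := hasExpansion_hilbert hm 0 f
  have hp := halfExp_pos hm
  have hσ := sphereArea_pos (Nat.succ_pos m)
  have hc : fpCoeff m 0 * (m - 1 + 2 * 0 : ℕ) = -(2 / sphereArea (m + 1)) := by
    rw [fpCoeff, mul_zero, add_zero, Nat.cast_sub (by omega)]
    have : (m : ℝ) - (1 : ℕ) = 2 * halfExp m := by unfold halfExp; push_cast; ring
    rw [this]; field_simp
  rw [hc, mul_zero, hasExpansion_zero_iff] at h
  simpa only [smul_smul, mul_zero, add_zero, Function.iterate_zero, id_eq] using h

theorem isBoundaryValue_hilbert (hm : 2 ≤ m) : IsBoundaryValue (potB m 0) (hilbert m) :=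
  (isBoundaryValue_potA_zero hm).neg_dirac (fun _ ht => contDiff_potA 0 ht)
    fun _ ht => dirac_potA hm 0 ht

/-- Two interlaced chains under -∂: A_{-1}, B_{-2}, A_{-3}, … starts from δ, and B_{-1}, A_{-2},
B_{-3}, … starts from H. -/
theorem isBoundaryValue_iterate (hm : 2 ≤ m) (hP : ∫ x, poisson m x = 1) : ∀ ℓ : ℕ,
    IsBoundaryValue (potA m (2 * ℓ + 1))
      ((fun T : CliffDist m => -diracD T)^[2 * ℓ] (delta m)) ∧
    IsBoundaryValue (potB m (2 * ℓ)) ((fun T : CliffDist m => -diracD T)^[2 * ℓ] (hilbert m)) ∧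
    IsBoundaryValue (potA m (2 * ℓ + 2))
      ((fun T : CliffDist m => -diracD T)^[2 * ℓ + 1] (hilbert m)) ∧
    IsBoundaryValue (potB m (2 * ℓ + 1))
      ((fun T : CliffDist m => -diracD T)^[2 * ℓ + 1] (delta m)) := by
  have hA : ∀ {k : ℕ} {T : CliffDist m}, IsBoundaryValue (potA m k) T →
      IsBoundaryValue (potB m k) (-diracD T) := fun h =>
    h.neg_dirac (fun _ ht => contDiff_potA _ ht) fun _ ht => dirac_potA hm _ ht
  have hB : ∀ {k : ℕ} {T : CliffDist m}, IsBoundaryValue (potB m k) T →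
      IsBoundaryValue (potA m (k + 2)) (-diracD T) := fun h =>
    h.neg_dirac (fun _ ht => contDiff_potB _ ht) fun _ ht => dirac_potB hm _ ht
  have key : ∀ ℓ : ℕ, IsBoundaryValue (potA m (2 * ℓ + 1))
      ((fun T : CliffDist m => -diracD T)^[2 * ℓ] (delta m)) ∧
      IsBoundaryValue (potB m (2 * ℓ))
        ((fun T : CliffDist m => -diracD T)^[2 * ℓ] (hilbert m)) := by
    intro ℓ
    induction ℓ with
    | zero => exact ⟨isBoundaryValue_potA_one hm hP, isBoundaryValue_hilbert hm⟩
    | succ ℓ ih =>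
      have h1 := hB (hA ih.1)
      have h2 := hA (hB ih.2)
      rw [← Function.iterate_succ_apply' (fun T : CliffDist m => -diracD T),
        ← Function.iterate_succ_apply' (fun T : CliffDist m => -diracD T)] at h1 h2
      exact ⟨h1, h2⟩
  intro ℓ
  refine ⟨(key ℓ).1, (key ℓ).2, ?_, ?_⟩
  · rw [Function.iterate_succ_apply']; exact hB (key ℓ).2
  · rw [Function.iterate_succ_apply']; exact hA (key ℓ).1

theorem iterate_neg_diracD_even (ℓ : ℕ) (T : CliffDist m) :
    (fun T : CliffDist m => -diracD T)^[2 * ℓ] T = diracD^[2 * ℓ] T := by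
  rw [iterate_neg_diracD, pow_mul]; simp

theorem isBoundaryValue_one (hm : 2 ≤ m) (hP : ∫ x, poisson m x = 1) :
    IsBoundaryValue (A m 1) (delta m) ∧ IsBoundaryValue (B m 1) (hilbert m) :=
  ⟨(isBoundaryValue_potA_one hm hP).congr fun _ ht x => (A_succ_eq hm 0 ht x).symm,
    (isBoundaryValue_hilbert hm).congr fun _ ht x => (B_succ_eq hm 0 ht x).symm⟩

theorem isBoundaryValue_even (hm : 2 ≤ m) (hP : ∫ x, poisson m x = 1) {ℓ : ℕ} (hℓ : 1 ≤ ℓ) :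
    IsBoundaryValue (A m (2 * ℓ)) ((fun T => -diracD T)^[2 * ℓ - 1] (hilbert m)) ∧
    IsBoundaryValue (B m (2 * ℓ)) ((fun T => -diracD T)^[2 * ℓ - 1] (delta m)) := by
  obtain ⟨l, rfl⟩ : ∃ l, ℓ = l + 1 := ⟨ℓ - 1, by omega⟩
  obtain ⟨-, -, h1, h2⟩ := isBoundaryValue_iterate hm hP l
  rw [show 2 * (l + 1) - 1 = 2 * l + 1 by omega, show 2 * (l + 1) = 2 * l + 1 + 1 by ring]
  exact ⟨h1.congr fun _ ht x => (A_succ_eq hm _ ht x).symm,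
    h2.congr fun _ ht x => (B_succ_eq hm _ ht x).symm⟩

theorem isBoundaryValue_odd (hm : 2 ≤ m) (hP : ∫ x, poisson m x = 1) (ℓ : ℕ) :
    IsBoundaryValue (A m (2 * ℓ + 1)) (diracD^[2 * ℓ] (delta m)) ∧
    IsBoundaryValue (B m (2 * ℓ + 1)) (diracD^[2 * ℓ] (hilbert m)) := by
  obtain ⟨h1, h2, -, -⟩ := isBoundaryValue_iterate hm hP ℓ
  rw [iterate_neg_diracD_even] at h1 h2
  exact ⟨h1.congr fun _ ht x => (A_succ_eq hm _ ht x).symm,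
    h2.congr fun _ ht x => (B_succ_eq hm _ ht x).symm⟩

/-- Successive coefficients have ratio -(m-1+2ℓ)(2ℓ+1). This is -(2ℓ+1)² for m = 2, hence two double
factorials, and -2(ℓ+1)(2ℓ+1) for m = 3, hence the powers of 2 and the factorial. -/
theorem fpCoeff_two (ℓ : ℕ) : fpCoeff 2 (ℓ + 1) =
    (-1) ^ ℓ * (1 / (2 * Real.pi)) * ((2 * (ℓ + 1) - 1)‼ : ℝ) * ((2 * (ℓ + 1) - 1)‼ : ℝ) := by
  have hπ := Real.pi_ne_zero
  induction ℓ with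
  | zero =>
    rw [fpCoeff, fpCoeff, halfExp_two, sphereArea_three]
    norm_num [Nat.doubleFactorial]
    field_simp
    norm_num
  | succ ℓ ih =>
    rw [fpCoeff, ih, show 2 * (ℓ + 1 + 1) - 1 = 2 * ℓ + 1 + 2 by omega,
      show 2 * (ℓ + 1) - 1 = 2 * ℓ + 1 by omega, Nat.doubleFactorial_add_two]
    push_cast
    ring

theorem fpCoeff_three (ℓ : ℕ) : fpCoeff 3 (ℓ + 1) =
    (-1) ^ ℓ * 2 ^ ℓ * ((2 * (ℓ + 1) - 1)‼ : ℝ) * ((ℓ + 1)! : ℝ) * (1 / Real.pi ^ 2) := by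
  have hπ := Real.pi_ne_zero
  induction ℓ with
  | zero =>
    rw [fpCoeff, fpCoeff, halfExp_three, sphereArea_four]
    norm_num [Nat.doubleFactorial]
    field_simp
  | succ ℓ ih =>
    rw [fpCoeff, ih, show 2 * (ℓ + 1 + 1) - 1 = 2 * ℓ + 1 + 2 by omega,
      show 2 * (ℓ + 1) - 1 = 2 * ℓ + 1 by omega, Nat.doubleFactorial_add_two,
      Nat.factorial_succ (ℓ + 1)]
    push_cast
    ring

theorem fpCoeff_two_ne_zero (ℓ : ℕ) : fpCoeff 2 (ℓ + 1) ≠ 0 := by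
  have hπ := Real.pi_ne_zero
  rw [fpCoeff_two]
  positivity

theorem fpCoeff_three_ne_zero (ℓ : ℕ) : fpCoeff 3 (ℓ + 1) ≠ 0 := by
  have hπ := Real.pi_ne_zero
  rw [fpCoeff_three]
  positivity

end HalfSpace
end

/-! ### Assembly of the theorem. -/

theorem mainTheorem5 :
    -- the decomposition of the downstream potentials, in both dimensions
    (∀ m : ℕ, m = 2 ∨ m = 3 → ∀ k : ℕ, 1 ≤ k →
      ContinuousOn (fun p : ℝ × HalfSpace.E m => HalfSpace.A m k p.1 p.2) {p | 0 < p.1} ∧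
      ContinuousOn (fun p : ℝ × HalfSpace.E m => HalfSpace.B m k p.1 p.2) {p | 0 < p.1} ∧
      ∀ x₀ : ℝ, 0 < x₀ → ∀ x : HalfSpace.E m,
        HalfSpace.A m k x₀ x ∈ HalfSpace.subCl m ∧
        HalfSpace.B m k x₀ x ∈ HalfSpace.subCl m ∧
        HalfSpace.C m k x₀ x = (1 / 2 : ℝ) • HalfSpace.A m k x₀ x +
          (1 / 2 : ℝ) • (HalfSpace.ebar0 m * HalfSpace.B m k x₀ x) ∧
        HalfSpace.A m (k + 1) x₀ x = HalfSpace.partial0 (HalfSpace.A m k) x₀ x ∧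
        HalfSpace.A m (k + 1) x₀ x = -HalfSpace.dirac (HalfSpace.B m k x₀) x ∧
        HalfSpace.B m (k + 1) x₀ x = HalfSpace.partial0 (HalfSpace.B m k) x₀ x ∧
        HalfSpace.B m (k + 1) x₀ x = -HalfSpace.dirac (HalfSpace.A m k x₀) x) ∧
    -- the Gegenbauer formulas for `m = 2`
    (∀ k : ℕ, 1 ≤ k → ∀ x₀ : ℝ, 0 < x₀ → ∀ x : HalfSpace.E 2, x ≠ 0 →
      (∃ a : ℝ, HalfSpace.A 2 k x₀ x = algebraMap ℝ (HalfSpace.Cl 2) a ∧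
        (a : ℂ) = (-1) ^ (k + 1) * (1 / (2 * (Real.pi : ℂ))) * (k ! : ℂ) *
          ((∏ i ∈ Finset.Icc 1 k, (2 * i - 1 : ℂ)) / (∏ i ∈ Finset.Icc (k + 1) (2 * k), (i : ℂ))) *
          (((‖x‖ ^ k / (x₀ ^ 2 + ‖x‖ ^ 2) ^ ((k : ℝ) + 1 / 2) : ℝ)) : ℂ) * Complex.I ^ k *
          Polynomial.aeval (Complex.I * ((x₀ / ‖x‖ : ℝ) : ℂ))
            (HalfSpace.gegenbauer k (-(k : ℝ)))) ∧
      (∃ b : ℝ, HalfSpace.B 2 k x₀ x = b • HalfSpace.vec x ∧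
        (b : ℂ) = (-1) ^ k * (1 / (2 * (Real.pi : ℂ))) * ((k - 1)! : ℂ) *
          ((∏ i ∈ Finset.Icc 2 k, (2 * i - 1 : ℂ)) / (∏ i ∈ Finset.Icc (k + 2) (2 * k), (i : ℂ))) *
          (((‖x‖ ^ (k - 1) / (x₀ ^ 2 + ‖x‖ ^ 2) ^ ((k : ℝ) + 1 / 2) : ℝ)) : ℂ) *
          Complex.I ^ (k - 1) *
          Polynomial.aeval (Complex.I * ((x₀ / ‖x‖ : ℝ) : ℂ))
            (HalfSpace.gegenbauer (k - 1) (-(k : ℝ))))) ∧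
    -- the Gegenbauer formulas for `m = 3`
    (∀ k : ℕ, 1 ≤ k → ∀ x₀ : ℝ, 0 < x₀ → ∀ x : HalfSpace.E 3, x ≠ 0 →
      (∃ a : ℝ, HalfSpace.A 3 k x₀ x = algebraMap ℝ (HalfSpace.Cl 3) a ∧
        (a : ℂ) = (-1) ^ (k + 1) * (1 / (Real.pi : ℂ) ^ 2) *
          (2 ^ (k - 1) * (k ! : ℂ) ^ 2 / (∏ i ∈ Finset.Icc (k + 2) (2 * k + 1), (i : ℂ))) *
          (((‖x‖ ^ k / (x₀ ^ 2 + ‖x‖ ^ 2) ^ (k + 1) : ℝ)) : ℂ) * Complex.I ^ k *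
          Polynomial.aeval (Complex.I * ((x₀ / ‖x‖ : ℝ) : ℂ))
            (HalfSpace.gegenbauer k (-(k : ℝ) - 1 / 2))) ∧
      (∃ b : ℝ, HalfSpace.B 3 k x₀ x = b • HalfSpace.vec x ∧
        (b : ℂ) = (-1) ^ k * (1 / (Real.pi : ℂ) ^ 2) *
          (2 ^ (k - 1) * ((k - 1)! : ℂ) * (k ! : ℂ) /
            (∏ i ∈ Finset.Icc (k + 3) (2 * k + 1), (i : ℂ))) *
          (((‖x‖ ^ (k - 1) / (x₀ ^ 2 + ‖x‖ ^ 2) ^ (k + 1) : ℝ)) : ℂ) * Complex.I ^ (k - 1) *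
          Polynomial.aeval (Complex.I * ((x₀ / ‖x‖ : ℝ) : ℂ))
            (HalfSpace.gegenbauer (k - 1) (-(k : ℝ) - 1 / 2)))) ∧
    -- the boundary values for `m = 2`
    (∃ H : HalfSpace.CliffDist 2,
      HalfSpace.IsPrincipalValue
        (fun x => (-(1 / (2 * Real.pi)) * (‖x‖ ^ 2)⁻¹) • HalfSpace.omega x) H ∧
      HalfSpace.IsBoundaryValue (HalfSpace.A 2 1) (HalfSpace.delta 2) ∧
      HalfSpace.IsBoundaryValue (HalfSpace.B 2 1) H ∧
      ∀ ℓ : ℕ, 1 ≤ ℓ →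
        HalfSpace.IsBoundaryValue (HalfSpace.A 2 (2 * ℓ))
          ((fun T => -HalfSpace.diracD T)^[2 * ℓ - 1] H) ∧
        (∃ T : HalfSpace.CliffDist 2,
          HalfSpace.IsFinitePart (fun x => (‖x‖ ^ (2 * ℓ + 1))⁻¹ • (1 : HalfSpace.Cl 2)) T ∧
          (fun T => -HalfSpace.diracD T)^[2 * ℓ - 1] H =
            ((-1) ^ (ℓ - 1) * (1 / (2 * Real.pi)) *
              ((2 * ℓ - 1)‼ : ℝ) * ((2 * ℓ - 1)‼ : ℝ)) • T) ∧
        HalfSpace.IsBoundaryValue (HalfSpace.B 2 (2 * ℓ))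
          ((fun T => -HalfSpace.diracD T)^[2 * ℓ - 1] (HalfSpace.delta 2)) ∧
        HalfSpace.IsBoundaryValue (HalfSpace.A 2 (2 * ℓ + 1))
          (HalfSpace.diracD^[2 * ℓ] (HalfSpace.delta 2)) ∧
        HalfSpace.IsBoundaryValue (HalfSpace.B 2 (2 * ℓ + 1)) (HalfSpace.diracD^[2 * ℓ] H) ∧
        (∃ T : HalfSpace.CliffDist 2,
          HalfSpace.IsFinitePart (fun x => (‖x‖ ^ (2 * ℓ + 2))⁻¹ • HalfSpace.omega x) T ∧
          HalfSpace.diracD^[2 * ℓ] H =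
            ((-1) ^ (ℓ - 1) * (1 / (2 * Real.pi)) *
              ((2 * ℓ - 1)‼ : ℝ) * ((2 * ℓ + 1)‼ : ℝ)) • T)) ∧
    -- the boundary values for `m = 3`
    (∃ H : HalfSpace.CliffDist 3,
      HalfSpace.IsPrincipalValue
        (fun x => (-(1 / Real.pi ^ 2) * (‖x‖ ^ 3)⁻¹) • HalfSpace.omega x) H ∧
      HalfSpace.IsBoundaryValue (HalfSpace.A 3 1) (HalfSpace.delta 3) ∧
      HalfSpace.IsBoundaryValue (HalfSpace.B 3 1) H ∧
      ∀ ℓ : ℕ, 1 ≤ ℓ →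
        HalfSpace.IsBoundaryValue (HalfSpace.A 3 (2 * ℓ))
          ((fun T => -HalfSpace.diracD T)^[2 * ℓ - 1] H) ∧
        (∃ T : HalfSpace.CliffDist 3,
          HalfSpace.IsFinitePart (fun x => (‖x‖ ^ (2 * ℓ + 2))⁻¹ • (1 : HalfSpace.Cl 3)) T ∧
          (fun T => -HalfSpace.diracD T)^[2 * ℓ - 1] H =
            ((-1) ^ (ℓ - 1) * 2 ^ (ℓ - 1) * ((2 * ℓ - 1)‼ : ℝ) * (ℓ ! : ℝ) *
              (1 / Real.pi ^ 2)) • T) ∧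
        HalfSpace.IsBoundaryValue (HalfSpace.B 3 (2 * ℓ))
          ((fun T => -HalfSpace.diracD T)^[2 * ℓ - 1] (HalfSpace.delta 3)) ∧
        HalfSpace.IsBoundaryValue (HalfSpace.A 3 (2 * ℓ + 1))
          (HalfSpace.diracD^[2 * ℓ] (HalfSpace.delta 3)) ∧
        HalfSpace.IsBoundaryValue (HalfSpace.B 3 (2 * ℓ + 1)) (HalfSpace.diracD^[2 * ℓ] H) ∧
        (∃ T : HalfSpace.CliffDist 3,
          HalfSpace.IsFinitePart (fun x => (‖x‖ ^ (2 * ℓ + 3))⁻¹ • HalfSpace.omega x) T ∧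
          HalfSpace.diracD^[2 * ℓ] H =
            ((-1) ^ (ℓ - 1) * 2 ^ ℓ * ((2 * ℓ - 1)‼ : ℝ) * ((ℓ + 1)! : ℝ) *
              (1 / Real.pi ^ 2)) • T)) := by
  have hB : ∀ n : ℕ, n + 1 - 1 = n := fun n => Nat.add_sub_cancel n 1
  refine ⟨fun m hm k hk => ?_, fun k hk x₀ ht x hx => ?_, fun k hk x₀ ht x hx => ?_,
    ⟨HalfSpace.hilbert 2, ?_, ?_, ?_, fun ℓ hℓ => ?_⟩,
    ⟨HalfSpace.hilbert 3, ?_, ?_, ?_, fun ℓ hℓ => ?_⟩⟩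
  · obtain ⟨n, rfl⟩ := Nat.exists_eq_add_of_le' hk
    exact HalfSpace.potentials_decomposition (by omega) n
  · obtain ⟨n, rfl⟩ := Nat.exists_eq_add_of_le' hk
    rw [hB]
    exact ⟨HalfSpace.A_two_eq n ht hx, HalfSpace.B_two_eq n ht hx⟩
  · obtain ⟨n, rfl⟩ := Nat.exists_eq_add_of_le' hk
    rw [hB]
    exact ⟨HalfSpace.A_three_eq n ht hx, HalfSpace.B_three_eq n ht hx⟩
  · have h := HalfSpace.isPrincipalValue_hilbert (m := 2) le_rfl
    rwa [show 2 / HalfSpace.sphereArea (2 + 1) = 1 / (2 * Real.pi) by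
      rw [HalfSpace.sphereArea_three]; field_simp; norm_num] at h
  · exact (HalfSpace.isBoundaryValue_one le_rfl HalfSpace.integral_poisson_two).1
  · exact (HalfSpace.isBoundaryValue_one le_rfl HalfSpace.integral_poisson_two).2
  · have he := HalfSpace.isBoundaryValue_even le_rfl HalfSpace.integral_poisson_two hℓ
    have ho := HalfSpace.isBoundaryValue_odd le_rfl HalfSpace.integral_poisson_two ℓ
    obtain ⟨n, rfl⟩ := Nat.exists_eq_add_of_le' hℓ
    have hc := HalfSpace.fpCoeff_two_ne_zero n
    obtain ⟨S, hS, hS'⟩ := HalfSpace.exists_isFinitePart_scalar le_rfl hℓ hc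
    obtain ⟨T, hT, hT'⟩ := HalfSpace.exists_isFinitePart_vector le_rfl hc
    refine ⟨he.1, ⟨S, ?_, ?_⟩, he.2, ho.1, ho.2, ⟨T, ?_, ?_⟩⟩
    · rwa [show 2 - 1 + 2 * (n + 1) = 2 * (n + 1) + 1 by omega] at hS
    · rw [hS', HalfSpace.fpCoeff_two, hB]
    · rwa [add_comm 2 (2 * (n + 1))] at hT
    -- With ℓ = n + 1, the extra factor m-1+2ℓ = 2ℓ+1 turns one (2ℓ-1)!! into (2ℓ+1)!!.
    · rw [hT', HalfSpace.fpCoeff_two, hB, show 2 - 1 + 2 * (n + 1) = 2 * n + 1 + 2 by omega,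
        show 2 * (n + 1) + 1 = 2 * n + 1 + 2 by omega, Nat.doubleFactorial_add_two,
        show 2 * (n + 1) - 1 = 2 * n + 1 by omega]
      congr 1
      push_cast
      ring
  · have h := HalfSpace.isPrincipalValue_hilbert (m := 3) (by norm_num)
    rwa [show 2 / HalfSpace.sphereArea (3 + 1) = 1 / Real.pi ^ 2 by
      rw [HalfSpace.sphereArea_four]; field_simp] at h
  · exact (HalfSpace.isBoundaryValue_one (by norm_num) HalfSpace.integral_poisson_three).1
  · exact (HalfSpace.isBoundaryValue_one (by norm_num) HalfSpace.integral_poisson_three).2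
  · have he := HalfSpace.isBoundaryValue_even (by norm_num) HalfSpace.integral_poisson_three hℓ
    have ho := HalfSpace.isBoundaryValue_odd (by norm_num) HalfSpace.integral_poisson_three ℓ
    obtain ⟨n, rfl⟩ := Nat.exists_eq_add_of_le' hℓ
    have hc := HalfSpace.fpCoeff_three_ne_zero n
    obtain ⟨S, hS, hS'⟩ := HalfSpace.exists_isFinitePart_scalar (by norm_num) hℓ hc
    obtain ⟨T, hT, hT'⟩ := HalfSpace.exists_isFinitePart_vector (by norm_num) hc
    refine ⟨he.1, ⟨S, ?_, ?_⟩, he.2, ho.1, ho.2, ⟨T, ?_, ?_⟩⟩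
    · rwa [show 3 - 1 + 2 * (n + 1) = 2 * (n + 1) + 2 by omega] at hS
    · rw [hS', HalfSpace.fpCoeff_three, hB]
    · rwa [add_comm 3 (2 * (n + 1))] at hT
    -- With ℓ = n + 1, the extra factor m-1+2ℓ = 2(ℓ+1) raises 2^(ℓ-1) ℓ! to 2^ℓ (ℓ+1)!.
    · rw [hT', HalfSpace.fpCoeff_three, hB, show 3 - 1 + 2 * (n + 1) = 2 * (n + 2) by omega,
        Nat.factorial_succ (n + 1)]
      congr 1
      push_cast
      ring
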